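/- A (randomized, multi-pass) streaming algorithm has a finite set of memory states; it starts in a random state, reads a sequence of tokens one at a time, in each step moving to a random new state whose distribution depends only on the current state and on the token read, makes a fixed number of passes over the same sequence, and finally outputs a function of its state. Its space is the number of bits needed to store a state, $\lceil\log_2 \#\text{states}\rceil$; in particular, random choices that are to be used again (such as hash functions) have to be stored and are counted. In the streaming-set model the input consists of sets $S_1,\dots,S_m\subseteq[n]=\{1,\dots,n\}$. In each pass the algorithm reads, for $i=1,\dots,m$, the identifier $i$ followed by the elements of $S_i$ one at a time, listed in an arbitrary order without repetition (the same order in every pass), and then an end-of-pass mark. For an integer $k\ge 1$ let $\mathrm{OPT}_k$ be the maximum of $\bigl|\bigcup_{i\in I}S_i\bigr|$ over all $I\subseteq\{1,\dots,m\}$ with $|I|\le k$. **Theorem.** There are absolute constants $P\in\mathbb R$ and $d\in\mathbb N$ such that for every $c\in\mathbb N$ there are a constant $C\in\mathbb R$ (depending only on $c$) and, for all integers $n,m,k\ge 1$ and all $\varepsilon\in(0,1)$, a streaming algorithm $A_{n,m,k,\varepsilon}$ that makes at most $P/\varepsilon$ passes, uses at most $$C\,\varepsilon^{-2}k\,\bigl(\log(2nm/\varepsilon)\bigr)^d$$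 bits of space, and on every stream of $m$ sets $S_1,\dots,S_m\subseteq[n]$ outputs, with probability at least $1-(nm)^{-c}$, a set $I$ of at most $k$ identifiers with $$\Bigl|\bigcup_{i\in I}S_i\Bigr|\ \ge\ \Bigl(1-\frac1e-\varepsilon\Bigr)\,\mathrm{OPT}_k .$$ That is: there is an $O(\varepsilon^{-1})$-pass, $\tilde O(\varepsilon^{-2}k)$-space streaming algorithm that finds a $(1-1/e-\varepsilon)$-approximation of maximum $k$-set coverage with high probability. -/

import Mathlib

/-- A randomized multi-pass streaming algorithm reading tokens of type `Tok`.
Its whole memory is a state in a finite type. Every step draws fresh random coins, so whatever the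
algorithm wants to remember about its randomness (a hash function, say) is part of the state. -/
structure StreamAlg (Tok Out : Type) where
  /-- The contents that the memory can take. -/
  State : Type
  [fintypeState : Fintype State]
  /-- The number of passes over the stream. -/
  passes : ℕ
  /-- The (random) initial contents of the memory. -/
  init : PMF State
  /-- The (random) change of the memory caused by reading one token. -/
  update : State → Tok → PMF State
  /-- The answer, read off the memory after the last pass. -/
  output : State → Out

namespace StreamAlg

variable {Tok Out : Type}

/-- The space in bits: the least `s` such that every state can be stored in `s` bits. -/
def space (A : StreamAlg Tok Out) : ℕ :=
  letI := A.fintypeState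
  Nat.clog 2 (Fintype.card A.State)

/-- Read a list of tokens, one by one from left to right, starting in memory state `s`. -/
noncomputable def feed (A : StreamAlg Tok Out) : A.State → List Tok → PMF A.State
  | s, [] => PMF.pure s
  | s, t :: l => (A.update s t).bind fun s' => A.feed s' l

/-- The law of the answer when every one of the passes reads the token list `l`. -/
noncomputable def run (A : StreamAlg Tok Out) (l : List Tok) : PMF Out :=
  (A.init.bind fun s => A.feed s (List.replicate A.passes l).flatten).map A.output

end StreamAlg

/-- The tokens of a stream of `m` subsets of `{0, …, n - 1}`: the identifier of a set, announcing
that its elements follow; one element of the current set; the mark at the end of a pass. -/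
inductive SetToken (n m : ℕ) : Type
  | set (i : Fin m) : SetToken n m
  | elem (e : Fin n) : SetToken n m
  | endOfPass : SetToken n m

/-- What one pass over the sets `L 0, …, L (m - 1)` reads: for each set its identifier and then its
elements, in the order in which `L` lists them; finally the end mark. -/
def setStream {n m : ℕ} (L : Fin m → List (Fin n)) : List (SetToken n m) :=
  ((List.finRange m).flatMap fun i => SetToken.set i :: (L i).map SetToken.elem) ++
    [SetToken.endOfPass]

/-- The number of distinct elements covered by the sets whose identifiers are in `I`. -/
def coverage {n m : ℕ} (L : Fin m → List (Fin n)) (I : Finset (Fin m)) : ℕ :=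
  (I.biUnion fun i => (L i).toFinset).card

/-- The largest number of elements that can be covered by at most `k` of the sets. -/
def optCoverage {n m : ℕ} (L : Fin m → List (Fin n)) (k : ℕ) : ℕ :=
  (Finset.univ.filter fun I : Finset (Fin m) => I.card ≤ k).sup (coverage L)

/-!
The algorithm combines three ideas.

*Sampling the universe.* If the optimum is about `v`, then keeping every element with probability
`1 / Q`, where `v / Q` is about `K = O(ε⁻² k log (n m / ε))` (and `Q = 1` if `v < K`), preserves the
coverage of the at most `(m + 1) ^ k` candidate solutions up to an additive error `η v`, where
`η = ε / 10` and no solution covers more than `v` elements (`card_badSamples_le`: Chernoff's bound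
and a union bound). At most `K` sampled elements are covered by a solution, so the sampled part of
a solution can be stored. A fully random sampling function cannot be stored, but by Newman's
argument (`exists_table`) it can be drawn from a fixed table of polynomial size, and only its index
there is kept in memory.

*Threshold greedy.* On the sample, every pass picks each set that covers at least `τ` new elements,
and `τ` is multiplied by `1 - η` from pass to pass. A picked set covers at least a fraction
`(1 - η) / k` of what is missing to the optimum, as in the greedy algorithm; and if the threshold
falls by a constant factor without `k` sets being picked, hardly anything is missing. This takes
`O(1 / η)` passes, because the guess `v` fixes the initial threshold up to a constant factor
(`Picked.card_cov_passes_ge`).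

*Guessing the optimum.* All powers of two are tried in parallel. A run with a bad guess is aborted if
its memory overflows; otherwise `Q` times the number of covered sampled elements, minus `η v`, is at
most `1 + η` times the coverage of its solution (`value_guessRun_le`). For the right guess this
value is nearly `(1 - 1 / e)` times the optimum (`le_value_guessRun`), so the solution of largest
value is good enough (`bestAnswer_guessRun`).
-/

/-! ### Chernoff's bound by counting functions -/

open Finset in
/-- The exponential moment of the number of `t ∈ D` with `ω t ∈ B`, for a uniformly random function `ω`. -/
theorem sum_exp_card_filter_le {ι Ω : Type*} [Fintype ι] [DecidableEq ι] [Fintype Ω]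
    [DecidableEq Ω] [Nonempty Ω] (D : Finset ι) (B : Finset Ω) (s : ℝ) :
    ∑ ω : ι → Ω, Real.exp (s * (D.filter fun t => ω t ∈ B).card) ≤
      (Fintype.card (ι → Ω) : ℝ) *
        Real.exp ((Real.exp s - 1) * ((B.card : ℝ) / Fintype.card Ω) * D.card) := by
  have hΩ : (0 : ℝ) < Fintype.card Ω := by exact_mod_cast Fintype.card_pos
  have h1 : ∀ ω : ι → Ω, Real.exp (s * (D.filter fun t => ω t ∈ B).card) =
      ∏ t, (if t ∈ D ∧ ω t ∈ B then Real.exp s else 1) := by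
    intro ω
    rw [Finset.prod_ite, Finset.prod_const, Finset.prod_const_one, mul_one, mul_comm,
      Real.exp_nat_mul]
    congr 2
    ext t
    simp
  have h2 : ∀ t : ι, ∑ x : Ω, (if t ∈ D ∧ x ∈ B then Real.exp s else (1 : ℝ)) ≤
      Fintype.card Ω *
        (if t ∈ D then Real.exp ((Real.exp s - 1) * ((B.card : ℝ) / Fintype.card Ω)) else 1) := by
    intro t
    by_cases ht : t ∈ D
    · have : ∑ x : Ω, (if t ∈ D ∧ x ∈ B then Real.exp s else (1 : ℝ)) =
          Fintype.card Ω * ((Real.exp s - 1) * ((B.card : ℝ) / Fintype.card Ω) + 1) := by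
        have h3 : ∀ x : Ω, (if t ∈ D ∧ x ∈ B then Real.exp s else (1 : ℝ)) =
            1 + (if x ∈ B then Real.exp s - 1 else 0) := by
          intro x; by_cases hx : x ∈ B <;> simp [ht, hx]
        simp only [h3]
        rw [Finset.sum_add_distrib, ← Finset.sum_filter]
        simp
        field_simp
        ring
      rw [this, if_pos ht]
      exact mul_le_mul_of_nonneg_left (Real.add_one_le_exp _) hΩ.le
    · simp [ht]
  calc ∑ ω : ι → Ω, Real.exp (s * (D.filter fun t => ω t ∈ B).card)
      = ∏ t : ι, ∑ x : Ω, (if t ∈ D ∧ x ∈ B then Real.exp s else (1 : ℝ)) := by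
        rw [Finset.prod_univ_sum, Fintype.piFinset_univ]
        exact Finset.sum_congr rfl fun ω _ => h1 ω
    _ ≤ ∏ t : ι, ((Fintype.card Ω : ℝ) *
        (if t ∈ D then Real.exp ((Real.exp s - 1) * ((B.card : ℝ) / Fintype.card Ω)) else 1)) :=
        Finset.prod_le_prod (fun t _ => Finset.sum_nonneg fun x _ => by positivity) fun t _ => h2 t
    _ = _ := by
        rw [Finset.prod_mul_distrib, Finset.prod_const, ← Finset.prod_filter, Finset.prod_const,
          mul_comm (_ * _ : ℝ) (D.card : ℝ), Real.exp_nat_mul]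
        simp

open Finset in
/-- Chernoff's bound (Markov's inequality for the exponential moment), as a count of functions. -/
theorem card_filter_le_exp {ι Ω : Type*} [Fintype ι] [DecidableEq ι] [Fintype Ω]
    [DecidableEq Ω] [Nonempty Ω] (D : Finset ι) (B : Finset Ω) (s y : ℝ)
    (P : (ι → Ω) → Prop) [DecidablePred P]
    (hP : ∀ ω, P ω → y ≤ s * (D.filter fun t => ω t ∈ B).card) :
    ((univ.filter P).card : ℝ) ≤ (Fintype.card (ι → Ω) : ℝ) *
        Real.exp ((Real.exp s - 1) * ((B.card : ℝ) / Fintype.card Ω) * D.card - y) := by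
  have h := sum_exp_card_filter_le D B s
  have h1 : ((univ.filter P).card : ℝ) * Real.exp y ≤
      ∑ ω : ι → Ω, Real.exp (s * (D.filter fun t => ω t ∈ B).card) := by
    calc ((univ.filter P).card : ℝ) * Real.exp y = ∑ ω ∈ univ.filter P, Real.exp y := by simp
      _ ≤ ∑ ω ∈ univ.filter P, Real.exp (s * (D.filter fun t => ω t ∈ B).card) := by
          refine Finset.sum_le_sum fun ω hω => Real.exp_le_exp.2 (hP ω (by simpa using hω))
      _ ≤ _ := Finset.sum_le_univ_sum_of_nonneg fun ω => by positivity
  rw [Real.exp_sub, ← mul_div_assoc, le_div_iff₀ (Real.exp_pos y)]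
  exact h1.trans h

/-! ### Small tables of random strings -/

/-- The derandomization argument of Newman: if for each of at most `2 ^ N` inputs at most a fraction
`δ / 4` of the random strings is bad, then some table of `T ≥ 2 * N / δ` strings contains, for
every input, at most a fraction `δ` of bad entries. Indeed a random table does, by Chernoff's bound
and a union bound over the inputs. -/
theorem exists_table {Ω 𝓛 : Type*} [Fintype Ω] [DecidableEq Ω] [Nonempty Ω] [Fintype 𝓛]
    (bad : 𝓛 → Finset Ω) {δ : ℝ} {N T : ℕ} (hN : 0 < N)
    (hcard : Fintype.card 𝓛 ≤ 2 ^ N) (hT : 2 * N ≤ δ * T)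
    (hbad : ∀ l, ((bad l).card : ℝ) ≤ δ / 4 * Fintype.card Ω) :
    ∃ ω : Fin T → Ω, ∀ l,
      ((Finset.univ.filter fun t => ω t ∈ bad l).card : ℝ) ≤ δ * T := by
  by_contra! hcon
  have hΩ : (0 : ℝ) < Fintype.card Ω := by exact_mod_cast Fintype.card_pos
  have hTp : (0 : ℝ) < Fintype.card (Fin T → Ω) := by exact_mod_cast Fintype.card_pos
  have h1 : ∀ l, ((Finset.univ.filter fun ω : Fin T → Ω =>
      δ * T < ((Finset.univ.filter fun t => ω t ∈ bad l).card : ℝ)).card : ℝ) ≤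
      Fintype.card (Fin T → Ω) * Real.exp (-N) := by
    intro l
    refine (card_filter_le_exp Finset.univ (bad l) 1 (δ * T) _ fun ω hω => by
      linarith).trans ?_
    refine mul_le_mul_of_nonneg_left (Real.exp_le_exp.2 ?_) hTp.le
    have h2 : ((bad l).card : ℝ) / Fintype.card Ω ≤ δ / 4 := by
      rw [div_le_iff₀ hΩ]; exact hbad l
    have h3 := Real.exp_one_lt_d9
    have h4 : (Real.exp 1 - 1) * (((bad l).card : ℝ) / Fintype.card Ω) ≤ 2 * (δ / 4) := by
      have h5 : (0 : ℝ) ≤ ((bad l).card : ℝ) / Fintype.card Ω := by positivity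
      nlinarith
    have h6 := mul_le_mul_of_nonneg_right h4 (Nat.cast_nonneg (α := ℝ) T)
    simp only [Finset.card_univ, Fintype.card_fin]
    linarith
  have h2 : (Finset.univ : Finset (Fin T → Ω)) ⊆ (Finset.univ : Finset 𝓛).biUnion fun l =>
      (Finset.univ.filter fun ω : Fin T → Ω =>
      δ * T < ((Finset.univ.filter fun t => ω t ∈ bad l).card : ℝ)) := by
    intro ω _
    obtain ⟨l, hl⟩ := hcon ω
    simp only [Finset.mem_biUnion, Finset.mem_univ, Finset.mem_filter, true_and]
    exact ⟨l, hl⟩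
  have h3 : (Fintype.card (Fin T → Ω) : ℝ) ≤ ∑ l : 𝓛, ((Finset.univ.filter fun ω : Fin T → Ω =>
      δ * T < ((Finset.univ.filter fun t => ω t ∈ bad l).card : ℝ)).card : ℝ) := by
    exact_mod_cast (Finset.card_le_card h2).trans Finset.card_biUnion_le
  have h4 : (Fintype.card (Fin T → Ω) : ℝ) ≤
      (2 : ℝ) ^ N * (Fintype.card (Fin T → Ω) * Real.exp (-N)) := by
    refine h3.trans ((Finset.sum_le_sum fun l _ => h1 l).trans ?_)
    rw [Finset.sum_const, nsmul_eq_mul]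
    refine mul_le_mul_of_nonneg_right ?_ (by positivity)
    rw [Finset.card_univ]
    exact_mod_cast hcard
  have h5 : (2 : ℝ) ^ N * Real.exp (-N) < 1 := by
    rw [Real.exp_neg, ← div_eq_mul_inv, div_lt_one (Real.exp_pos _)]
    have : Real.exp (N : ℝ) = Real.exp 1 ^ N := by rw [← Real.exp_nat_mul, mul_one]
    rw [this]
    exact pow_lt_pow_left₀ (by linarith [Real.exp_one_gt_d9]) (by norm_num) hN.ne'
  nlinarith

/-! ### Sampling the universe -/

/-- If every element of the universe is sampled with probability `1 / Q`, then `Q` times the number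
of sampled elements of `D` estimates `|D|` up to an error `η * max v |D|`. -/
theorem card_bad_sample_le {ι : Type*} [Fintype ι] [DecidableEq ι] (q : ℕ) (D : Finset ι)
    {η v : ℝ} (hη : 0 < η) (hη1 : η ≤ 1) :
    ((Finset.univ.filter fun h : ι → Fin (q + 1) => η * max v D.card <
        |((q + 1 : ℕ) : ℝ) * (D.filter fun e => h e = 0).card - D.card|).card : ℝ) ≤
      2 * Real.exp (-(η ^ 2 * v / (4 * (q + 1 : ℕ)))) *
        Fintype.card (ι → Fin (q + 1)) := by
  set Q : ℝ := ((q + 1 : ℕ) : ℝ) with hQ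
  have hQ0 : 0 < Q := by positivity
  set M : ℝ := max v D.card
  have hMv : v ≤ M := le_max_left _ _
  have hMD : (D.card : ℝ) ≤ M := le_max_right _ _
  -- Both tails at once: `σ = 1` is the upper and `σ = -1` the lower one. The exponent `σ * (η / 2)`
  -- minimizes the resulting bound.
  have key : ∀ σ : ℝ, |σ| = 1 →
      ((Finset.univ.filter fun h : ι → Fin (q + 1) => η * M <
        σ * (Q * (D.filter fun e => h e = 0).card - D.card)).card : ℝ) ≤
      Fintype.card (ι → Fin (q + 1)) * Real.exp (-(η ^ 2 * v / (4 * Q))) := by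
    intro σ hσ
    have hσ2 : σ ^ 2 = 1 := by rw [← sq_abs, hσ, one_pow]
    refine (card_filter_le_exp D ({0} : Finset (Fin (q + 1))) (σ * (η / 2))
      (σ * (η / 2) * (D.card / Q) + η / 2 * (η * M / Q)) _ ?_).trans ?_
    · intro h hh
      simp only [Finset.mem_singleton]
      have : η * M / Q + σ * (D.card / Q) ≤ σ * (D.filter fun e => h e = 0).card := by
        rw [← mul_div_assoc, ← add_div, div_le_iff₀ hQ0]
        linarith
      nlinarith [mul_le_mul_of_nonneg_left this (half_pos hη).le]
    · refine mul_le_mul_of_nonneg_left (Real.exp_le_exp.2 ?_) (by positivity)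
      have h1 := Real.abs_exp_sub_one_sub_id_le (x := σ * (η / 2)) (by
        rw [abs_mul, hσ, abs_of_pos (half_pos hη)]; linarith)
      have h2 : Real.exp (σ * (η / 2)) - 1 - σ * (η / 2) ≤ η ^ 2 / 4 := by
        refine (le_abs_self _).trans (h1.trans (le_of_eq ?_))
        rw [mul_pow, hσ2]; ring
      simp only [Finset.card_singleton, Fintype.card_fin, ← hQ, Nat.cast_one]
      have h3 : (Real.exp (σ * (η / 2)) - 1 - σ * (η / 2)) * (D.card / Q) ≤
          η ^ 2 / 4 * (M / Q) := by
        calc _ ≤ η ^ 2 / 4 * ((D.card : ℝ) / Q) :=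
              mul_le_mul_of_nonneg_right h2 (by positivity)
          _ ≤ _ := by gcongr
      have h4 : η ^ 2 / 4 * (v / Q) ≤ η ^ 2 / 4 * (M / Q) := by gcongr
      have e1 : η ^ 2 * v / (4 * Q) = η ^ 2 / 4 * (v / Q) := by field_simp
      have e2 : η / 2 * (η * M / Q) = 2 * (η ^ 2 / 4 * (M / Q)) := by field_simp; ring
      have e3 : (Real.exp (σ * (η / 2)) - 1) * (1 / Q) * D.card =
          (Real.exp (σ * (η / 2)) - 1) * (D.card / Q) := by field_simp
      rw [e1, e2, e3]
      linarith
  have hsub : (Finset.univ.filter fun h : ι → Fin (q + 1) => η * M <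
        |Q * (D.filter fun e => h e = 0).card - D.card|) ⊆
      (Finset.univ.filter fun h : ι → Fin (q + 1) => η * M <
        1 * (Q * (D.filter fun e => h e = 0).card - D.card)) ∪
      (Finset.univ.filter fun h : ι → Fin (q + 1) => η * M <
        (-1) * (Q * (D.filter fun e => h e = 0).card - D.card)) := by
    intro h hh
    simp only [Finset.mem_filter, Finset.mem_univ, true_and, Finset.mem_union] at hh ⊢
    rcases lt_abs.1 hh with h1 | h1
    · left; linarith
    · right; linarith
  have hc : ((Finset.univ.filter fun h : ι → Fin (q + 1) => η * M <
        |Q * (D.filter fun e => h e = 0).card - D.card|).card : ℝ) ≤ _ :=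
    Nat.cast_le.2 ((Finset.card_le_card hsub).trans (Finset.card_union_le _ _))
  push_cast at hc
  linarith [key 1 (by simp), key (-1) (by simp)]

/-- A set with at most `k` elements is listed by a function from `Fin k`, padded by `none`. -/
theorem card_finset_card_le (α : Type*) [Fintype α] [DecidableEq α] (k : ℕ) :
    Fintype.card {s : Finset α // s.card ≤ k} ≤ (Fintype.card α + 1) ^ k := by
  classical
  rw [Fintype.card_subtype]
  calc (Finset.univ.filter fun s : Finset α => s.card ≤ k).card
      ≤ (Finset.univ.image fun g : Fin k → Option α =>
          (Finset.univ.filter fun x => ∃ i, g i = some x)).card := by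
        refine Finset.card_le_card fun s hs => ?_
        simp only [Finset.mem_filter, Finset.mem_univ, true_and] at hs
        refine Finset.mem_image.2 ⟨fun i => s.toList[(i : ℕ)]?, Finset.mem_univ _, ?_⟩
        ext x
        simp only [Finset.mem_filter, Finset.mem_univ, true_and]
        rw [← Finset.mem_toList, List.mem_iff_getElem?]
        constructor
        · rintro ⟨i, hi⟩; exact ⟨i, hi⟩
        · rintro ⟨i, hi⟩
          have : i < s.toList.length := by
            by_contra hcon
            rw [List.getElem?_eq_none (by omega)] at hi
            cases hi
          rw [Finset.length_toList] at this
          exact ⟨⟨i, by omega⟩, hi⟩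
    _ ≤ Fintype.card (Fin k → Option α) := Finset.card_image_le
    _ = _ := by simp

/-- The event that some union of at most `k` of the sets `S i` is badly estimated by its sample. -/
noncomputable def badSamples {n m : ℕ} (k q : ℕ) (η v : ℝ) (S : Fin m → Finset (Fin n)) :
    Finset (Fin n → Fin (q + 1)) := by
  classical
  exact Finset.univ.filter fun h => ∃ I : Finset (Fin m), I.card ≤ k ∧
    η * max v (I.biUnion S).card <
      |((q + 1 : ℕ) : ℝ) * ((I.biUnion S).filter fun e => h e = 0).card - (I.biUnion S).card|

theorem card_badSamples_le {n m : ℕ} (k q : ℕ) {η v : ℝ} (hη : 0 < η) (hη1 : η ≤ 1)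
    (S : Fin m → Finset (Fin n)) :
    ((badSamples k q η v S).card : ℝ) ≤
      (m + 1) ^ k * (2 * Real.exp (-(η ^ 2 * v / (4 * (q + 1 : ℕ)))) *
        Fintype.card (Fin n → Fin (q + 1))) := by
  classical
  have h1 : badSamples k q η v S ⊆
      (Finset.univ.filter fun I : Finset (Fin m) => I.card ≤ k).biUnion fun I =>
        Finset.univ.filter fun h : Fin n → Fin (q + 1) => η * max v (I.biUnion S).card <
          |((q + 1 : ℕ) : ℝ) * ((I.biUnion S).filter fun e => h e = 0).card -
            (I.biUnion S).card| := by
    intro h hh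
    simpa [badSamples] using hh
  have h2 := (Finset.card_le_card h1).trans Finset.card_biUnion_le
  have h3 : (Finset.univ.filter fun I : Finset (Fin m) => I.card ≤ k).card ≤ (m + 1) ^ k := by
    have := card_finset_card_le (Fin m) k
    rwa [Fintype.card_subtype, Fintype.card_fin] at this
  calc ((badSamples k q η v S).card : ℝ)
      ≤ ∑ I ∈ Finset.univ.filter fun I : Finset (Fin m) => I.card ≤ k, _ := by
        exact_mod_cast h2
    _ ≤ ∑ I ∈ Finset.univ.filter fun I : Finset (Fin m) => I.card ≤ k,
        (2 * Real.exp (-(η ^ 2 * v / (4 * (q + 1 : ℕ)))) *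
          Fintype.card (Fin n → Fin (q + 1))) :=
        Finset.sum_le_sum fun I _ => card_bad_sample_le q (I.biUnion S) hη hη1
    _ ≤ _ := by
        rw [Finset.sum_const, nsmul_eq_mul]
        refine mul_le_mul_of_nonneg_right ?_ (by positivity)
        exact_mod_cast h3

/-- If every element is sampled, no union is badly estimated. -/
theorem badSamples_zero {n m : ℕ} (k : ℕ) {η v : ℝ} (hη : 0 ≤ η) (hv : 0 ≤ v)
    (S : Fin m → Finset (Fin n)) : badSamples k 0 η v S = ∅ := by
  classical
  refine Finset.filter_eq_empty_iff.2 fun h _ => ?_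
  rintro ⟨I, _, hI⟩
  have h1 : ((I.biUnion S).filter fun e => h e = 0) = I.biUnion S :=
    Finset.filter_true_of_mem fun e _ => Fin.ext (by omega)
  rw [h1] at hI
  simp only [zero_add, Nat.cast_one, one_mul, sub_self, abs_zero] at hI
  exact absurd hI (not_lt.2 (mul_nonneg hη (hv.trans (le_max_left _ _))))

/-! ### Threshold greedy on sampled sets -/

/-- A partial solution: the identifiers picked so far, and the sampled elements they cover. -/
structure Picked (n m : ℕ) where
  cov : Finset (Fin n)
  sol : Finset (Fin m)

namespace Picked

variable {n m : ℕ}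

/-- Offer the set `i`, whose sampled elements are `E`: it is picked if fewer than `k` sets have been
picked and it covers at least `τ` new sampled elements. -/
noncomputable def offer (k : ℕ) (τ : ℝ) (E : Finset (Fin n)) (i : Fin m) (p : Picked n m) :
    Picked n m :=
  if p.sol.card < k ∧ τ ≤ (E \ p.cov).card then ⟨p.cov ∪ E, insert i p.sol⟩ else p

/-- At most `k` sets are picked, and the covered elements are those of the sampled sets `D i`. -/
def Valid (D : Fin m → Finset (Fin n)) (k : ℕ) (p : Picked n m) : Prop :=
  p.cov = p.sol.biUnion D ∧ p.sol.card ≤ k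

theorem Valid.offer {D : Fin m → Finset (Fin n)} {k : ℕ} {p : Picked n m} (hp : p.Valid D k)
    (τ : ℝ) (i : Fin m) : (p.offer k τ (D i) i).Valid D k := by
  unfold Picked.offer
  split_ifs with h
  · refine ⟨?_, (Finset.card_insert_le _ _).trans h.1⟩
    simp only [Finset.biUnion_insert, hp.1]
    exact Finset.union_comm _ _
  · exact hp

theorem cov_subset_offer (k : ℕ) (τ : ℝ) (E : Finset (Fin n)) (i : Fin m) (p : Picked n m) :
    p.cov ⊆ (p.offer k τ E i).cov := by
  unfold offer
  split_ifs
  · exact Finset.subset_union_left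
  · exact subset_rfl

theorem offer_of_card_eq {k : ℕ} {p : Picked n m} (h : p.sol.card = k) (τ : ℝ)
    (E : Finset (Fin n)) (i : Fin m) : p.offer k τ E i = p := by
  unfold offer
  rw [if_neg]
  rintro ⟨h1, -⟩
  omega

/-- The set `i` need not be considered any more at threshold `τ`. -/
def Settled (D : Fin m → Finset (Fin n)) (k : ℕ) (τ : ℝ) (p : Picked n m) (i : Fin m) : Prop :=
  p.sol.card = k ∨ ((D i \ p.cov).card : ℝ) ≤ τ

theorem Settled.offer {D : Fin m → Finset (Fin n)} {k : ℕ} {τ : ℝ} {p : Picked n m} {i : Fin m}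
    (h : p.Settled D k τ i) (j : Fin m) : (p.offer k τ (D j) j).Settled D k τ i := by
  rcases h with h | h
  · rw [offer_of_card_eq h]; exact Or.inl h
  · refine Or.inr (le_trans ?_ h)
    exact_mod_cast Finset.card_le_card
      (Finset.sdiff_subset_sdiff subset_rfl (cov_subset_offer _ _ _ _ _))

theorem settled_offer_self {D : Fin m → Finset (Fin n)} {k : ℕ} {τ : ℝ} {p : Picked n m}
    (hp : p.Valid D k) (hτ : 0 ≤ τ) (i : Fin m) :
    (p.offer k τ (D i) i).Settled D k τ i := by
  unfold Picked.offer
  split_ifs with h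
  · right
    rw [Finset.sdiff_eq_empty_iff_subset.2 Finset.subset_union_right]
    simpa using hτ
  · rw [not_and_or] at h
    rcases h with h | h
    · exact Or.inl (le_antisymm hp.2 (not_lt.1 h))
    · exact Or.inr (not_le.1 h).le

/-- What the threshold greedy algorithm guarantees relative to a target of `x` covered elements when
it works with the threshold `w * (1 - η) ^ r / k`: the deficit decays geometrically with the number
of picked sets; and unless `k` sets are picked, the deficit is so small that every set that
meets the threshold covers at least a fraction `(1 - η) / k` of it. -/
structure Progress (D : Fin m → Finset (Fin n)) (k : ℕ) (η w x : ℝ) (r : ℕ) (p : Picked n m) :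
    Prop where
  valid : p.Valid D k
  decay : x - p.cov.card ≤ x * (1 - (1 - η) / k) ^ p.sol.card
  small : p.sol.card = k ∨ (1 - η) * (x - p.cov.card) ≤ w * (1 - η) ^ r

theorem Progress.offer {D : Fin m → Finset (Fin n)} {k : ℕ} {η w x : ℝ} {r : ℕ} {p : Picked n m}
    (hp : p.Progress D k η w x r) (hk : 0 < k) (hη : 0 ≤ η) (hη1 : η < 1) (hw : 0 < w)
    (i : Fin m) : (p.offer k (w * (1 - η) ^ r / k) (D i) i).Progress D k η w x r := by
  have hk' : (0 : ℝ) < k := by exact_mod_cast hk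
  have hk1 : (1 : ℝ) ≤ k := by exact_mod_cast hk
  have hη' : 0 < 1 - η := by linarith
  refine ⟨hp.valid.offer _ i, ?_, ?_⟩
  · by_cases h : p.sol.card < k ∧ w * (1 - η) ^ r / k ≤ ((D i \ p.cov).card : ℝ)
    · -- A set that was picked before covers nothing new, so it misses the positive threshold.
      have hi : i ∉ p.sol := by
        intro hi
        have h0 : D i \ p.cov = ∅ := by
          rw [Finset.sdiff_eq_empty_iff_subset, hp.valid.1]
          exact Finset.subset_biUnion_of_mem D hi
        have h1 := h.2
        rw [h0, Finset.card_empty, Nat.cast_zero] at h1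
        exact absurd h1 (not_le.2 (by positivity))
      have hs := hp.small.resolve_left h.1.ne
      rw [Picked.offer, if_pos h]
      have hcard : ((p.cov ∪ D i).card : ℝ) = p.cov.card + (D i \ p.cov).card := by
        rw [← Finset.union_sdiff_self_eq_union,
          Finset.card_union_of_disjoint Finset.disjoint_sdiff]
        push_cast; ring
      have hgain : (1 - η) / k * (x - p.cov.card) ≤ (D i \ p.cov).card := by
        refine le_trans ?_ h.2
        rw [div_mul_eq_mul_div]
        gcongr
      have hfac : 0 ≤ 1 - (1 - η) / k := by
        rw [sub_nonneg, div_le_one hk']; linarith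
      simp only [Finset.card_insert_of_notMem hi, hcard, pow_succ]
      calc x - (p.cov.card + (D i \ p.cov).card)
          ≤ (x - p.cov.card) * (1 - (1 - η) / k) := by linarith
        _ ≤ x * (1 - (1 - η) / k) ^ p.sol.card * (1 - (1 - η) / k) :=
            mul_le_mul_of_nonneg_right hp.decay hfac
        _ = _ := by ring
    · rw [Picked.offer, if_neg h]; exact hp.decay
  · rcases hp.small with h | h
    · rw [offer_of_card_eq h]; exact Or.inl h
    · right
      refine le_trans (mul_le_mul_of_nonneg_left ?_ hη'.le) h
      have := Finset.card_le_card (cov_subset_offer k (w * (1 - η) ^ r / k) (D i) i p)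
      have : (p.cov.card : ℝ) ≤ (p.offer k (w * (1 - η) ^ r / k) (D i) i).cov.card := by
        exact_mod_cast this
      linarith

theorem Valid.foldl_offer {D : Fin m → Finset (Fin n)} {k : ℕ} {p : Picked n m}
    (hp : p.Valid D k) (τ : ℝ) (l : List (Fin m)) :
    (l.foldl (fun p i => p.offer k τ (D i) i) p).Valid D k := by
  induction l generalizing p with
  | nil => exact hp
  | cons i l ih => exact ih (hp.offer τ i)

theorem Settled.foldl_offer {D : Fin m → Finset (Fin n)} {k : ℕ} {τ : ℝ} {p : Picked n m}
    {i : Fin m} (h : p.Settled D k τ i) (l : List (Fin m)) :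
    (l.foldl (fun p i => p.offer k τ (D i) i) p).Settled D k τ i := by
  induction l generalizing p with
  | nil => exact h
  | cons j l ih => exact ih (h.offer j)

theorem settled_foldl_offer {D : Fin m → Finset (Fin n)} {k : ℕ} {τ : ℝ} {p : Picked n m}
    (hp : p.Valid D k) (hτ : 0 ≤ τ) {i : Fin m} {l : List (Fin m)} (hi : i ∈ l) :
    (l.foldl (fun p i => p.offer k τ (D i) i) p).Settled D k τ i := by
  induction l generalizing p with
  | nil => simp at hi
  | cons j l ih =>
    rcases List.mem_cons.1 hi with rfl | hi
    · exact (settled_offer_self hp hτ i).foldl_offer l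
    · exact ih (hp.offer τ j) hi

theorem Progress.foldl_offer {D : Fin m → Finset (Fin n)} {k : ℕ} {η w x : ℝ} {r : ℕ}
    {p : Picked n m} (hp : p.Progress D k η w x r) (hk : 0 < k) (hη : 0 ≤ η) (hη1 : η < 1)
    (hw : 0 < w) (l : List (Fin m)) :
    (l.foldl (fun p i => p.offer k (w * (1 - η) ^ r / k) (D i) i) p).Progress D k η w x r := by
  induction l generalizing p with
  | nil => exact hp
  | cons i l ih => exact ih (hp.offer hk hη hη1 hw i)

/-- The partial solution after one pass that offers all sets at threshold `τ`. -/
noncomputable def pass (D : Fin m → Finset (Fin n)) (k : ℕ) (τ : ℝ) (p : Picked n m) :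
    Picked n m :=
  (List.finRange m).foldl (fun p i => p.offer k τ (D i) i) p

/-- After a pass no set covers many new elements, so neither do the `k` sets of `O` together. -/
theorem Progress.pass {D : Fin m → Finset (Fin n)} {k : ℕ} {η w : ℝ} {r : ℕ} {p : Picked n m}
    {O : Finset (Fin m)} (hO : O.card ≤ k) (hp : p.Progress D k η w (O.biUnion D).card r)
    (hk : 0 < k) (hη : 0 ≤ η) (hη1 : η < 1) (hw : 0 < w) :
    (p.pass D k (w * (1 - η) ^ r / k)).Progress D k η w (O.biUnion D).card (r + 1) := by
  have hk' : (0 : ℝ) < k := by exact_mod_cast hk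
  have hη' : 0 < 1 - η := by linarith
  have h := hp.foldl_offer hk hη hη1 hw (List.finRange m)
  refine ⟨h.valid, h.decay, ?_⟩
  by_cases hc : (p.pass D k (w * (1 - η) ^ r / k)).sol.card = k
  · exact Or.inl hc
  right
  have hτ : 0 ≤ w * (1 - η) ^ r / k := by positivity
  have hs : ∀ i, ((D i \ (p.pass D k (w * (1 - η) ^ r / k)).cov).card : ℝ) ≤
      w * (1 - η) ^ r / k := fun i =>
    (settled_foldl_offer hp.valid hτ (List.mem_finRange i)).resolve_left hc
  set c := (p.pass D k (w * (1 - η) ^ r / k)).cov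
  have h1 : (O.biUnion D) ⊆ c ∪ O.biUnion fun i => D i \ c := by
    intro e he
    obtain ⟨i, hi, hei⟩ := Finset.mem_biUnion.1 he
    by_cases hec : e ∈ c
    · exact Finset.mem_union_left _ hec
    · exact Finset.mem_union_right _
        (Finset.mem_biUnion.2 ⟨i, hi, Finset.mem_sdiff.2 ⟨hei, hec⟩⟩)
  have h2 : (O.biUnion D).card ≤ c.card + ∑ i ∈ O, (D i \ c).card :=
    (Finset.card_le_card h1).trans ((Finset.card_union_le _ _).trans
      (Nat.add_le_add_left Finset.card_biUnion_le _))
  have h3 : ((O.biUnion D).card : ℝ) ≤ c.card + ∑ i ∈ O, ((D i \ c).card : ℝ) := by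
    exact_mod_cast h2
  have h4 : ∑ i ∈ O, ((D i \ c).card : ℝ) ≤ w * (1 - η) ^ r := by
    calc ∑ i ∈ O, ((D i \ c).card : ℝ) ≤ ∑ i ∈ O, w * (1 - η) ^ r / k :=
          Finset.sum_le_sum fun i _ => hs i
      _ = O.card * (w * (1 - η) ^ r / k) := by rw [Finset.sum_const, nsmul_eq_mul]
      _ ≤ k * (w * (1 - η) ^ r / k) :=
          mul_le_mul_of_nonneg_right (by exact_mod_cast hO) hτ
      _ = _ := by field_simp
  rw [pow_succ, ← mul_assoc, mul_comm]
  exact mul_le_mul_of_nonneg_right (by linarith) hη'.le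

/-- The partial solution after `r` passes with geometrically decreasing thresholds. -/
noncomputable def passes (D : Fin m → Finset (Fin n)) (k : ℕ) (η w : ℝ) : ℕ → Picked n m
  | 0 => ⟨∅, ∅⟩
  | r + 1 => (passes D k η w r).pass D k (w * (1 - η) ^ r / k)

theorem valid_empty (D : Fin m → Finset (Fin n)) (k : ℕ) : (⟨∅, ∅⟩ : Picked n m).Valid D k :=
  ⟨rfl, Nat.zero_le _⟩

theorem valid_passes (D : Fin m → Finset (Fin n)) (k : ℕ) (η w : ℝ) (r : ℕ) :
    (passes D k η w r).Valid D k := by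
  induction r with
  | zero => exact valid_empty D k
  | succ r ih => exact ih.foldl_offer _ _

/-- Initially the deficit is `x ≤ w`, so the first threshold `w / k` is large enough. -/
theorem progress_passes {D : Fin m → Finset (Fin n)} {k : ℕ} {η w : ℝ}
    {O : Finset (Fin m)} (hO : O.card ≤ k) (hk : 0 < k) (hη : 0 ≤ η) (hη1 : η < 1) (hw : 0 < w)
    (hx : ((O.biUnion D).card : ℝ) ≤ w) (r : ℕ) :
    (passes D k η w r).Progress D k η w (O.biUnion D).card r := by
  induction r with
  | zero =>
    refine ⟨valid_empty D k, by simp [passes], Or.inr ?_⟩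
    have h0 : (0 : ℝ) ≤ (O.biUnion D).card := by positivity
    simp only [passes, Finset.card_empty, Nat.cast_zero, sub_zero, pow_zero, mul_one]
    nlinarith
  | succ r ih => exact ih.pass hO hk hη hη1 hw

/-- After `4 / η + 1` passes, starting at a guess `w` that is correct up to a factor of eight, the
threshold greedy algorithm is as good as the greedy algorithm up to an additive `η`. -/
theorem card_cov_passes_ge {D : Fin m → Finset (Fin n)} {k : ℕ} {η w : ℝ}
    {O : Finset (Fin m)} (hO : O.card ≤ k) (hk : 0 < k) (hη : 0 < η) (hη1 : η < 1) (hw : 0 < w)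
    (hx : ((O.biUnion D).card : ℝ) ≤ w) (hx8 : w ≤ 8 * ((O.biUnion D).card : ℝ)) {N : ℕ}
    (hN : 4 / η ≤ N) :
    (1 - 1 / Real.exp 1 - η) * (O.biUnion D).card ≤ ((passes D k η w (N + 1)).cov.card : ℝ) := by
  have hk' : (0 : ℝ) < k := by exact_mod_cast hk
  have hk1 : (1 : ℝ) ≤ k := by exact_mod_cast hk
  have hη' : 0 < 1 - η := by linarith
  have h := progress_passes hO hk hη.le hη1 hw hx (N + 1)
  set x : ℝ := ((O.biUnion D).card : ℝ)
  have hx0 : 0 ≤ x := by positivity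
  have he : Real.exp 1 * (1 / Real.exp 1) = 1 := by field_simp
  have he0 : (0 : ℝ) < 1 / Real.exp 1 := by positivity
  have he1 : 2 * (1 / Real.exp 1) ≤ 1 := by
    nlinarith [Real.exp_one_gt_d9]
  rcases h.small with hs | hs
  · have h1 := h.decay
    rw [hs] at h1
    have h2 : (1 - (1 - η) / k) ^ k ≤ Real.exp (-(1 - η)) := by
      have h3 : 1 - (1 - η) / k ≤ Real.exp (-((1 - η) / k)) := by
        linarith [Real.add_one_le_exp (-((1 - η) / k))]
      have hfac : 0 ≤ 1 - (1 - η) / k := by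
        rw [sub_nonneg, div_le_one hk']; linarith
      calc _ ≤ Real.exp (-((1 - η) / k)) ^ k := pow_le_pow_left₀ hfac h3 k
        _ = _ := by rw [← Real.exp_nat_mul]; congr 1; field_simp
    have h4 : Real.exp (-(1 - η)) ≤ 1 / Real.exp 1 + η := by
      have h5 : Real.exp (-(1 - η)) = 1 / Real.exp 1 * Real.exp η := by
        rw [one_div, ← Real.exp_neg, ← Real.exp_add]; congr 1; ring
      have h6 : Real.exp η ≤ 1 + 2 * η := by
        have := Real.abs_exp_sub_one_le (x := η) (by rw [abs_of_pos hη]; exact hη1.le)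
        rw [abs_of_pos hη] at this
        linarith [le_abs_self (Real.exp η - 1)]
      rw [h5]
      nlinarith
    nlinarith [mul_le_mul_of_nonneg_left (h2.trans h4) hx0]
  · have h1 : x - (passes D k η w (N + 1)).cov.card ≤ w * (1 - η) ^ N := by
      rw [pow_succ, ← mul_assoc, mul_comm] at hs
      exact le_of_mul_le_mul_right hs hη'
    have h2 : (1 - η) ^ N ≤ Real.exp (-4) := by
      calc (1 - η) ^ N ≤ Real.exp (-η) ^ N :=
            pow_le_pow_left₀ hη'.le (by linarith [Real.add_one_le_exp (-η)]) N
        _ = Real.exp (N * (-η)) := by rw [← Real.exp_nat_mul]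
        _ ≤ Real.exp (-4) := by
            rw [div_le_iff₀ hη] at hN
            exact Real.exp_le_exp.2 (by linarith)
    -- The constant four suffices because `8 ≤ exp 3`.
    have h3 : 8 * Real.exp (-4) ≤ 1 / Real.exp 1 := by
      have h4 : Real.exp (-4) = (1 / Real.exp 1) ^ 4 := by
        rw [one_div, ← Real.exp_neg, ← Real.exp_nat_mul]; norm_num
      rw [h4]
      have h5 : (1 / Real.exp 1) ^ 3 ≤ (1 / 2) ^ 3 :=
        pow_le_pow_left₀ he0.le (by linarith) 3
      nlinarith
    have h6 : w * (1 - η) ^ N ≤ 8 * x * Real.exp (-4) :=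
      mul_le_mul hx8 h2 (by positivity) (by positivity)
    nlinarith [mul_le_mul_of_nonneg_left h3 hx0, mul_nonneg hη.le hx0]

end Picked

/-! ### The memory of threshold greedy -/

/-- The memory of the threshold greedy algorithm: the partial solution, the set that is currently
being read together with its sampled elements read so far, and the number of completed passes. -/
structure GreedyMemory (n m : ℕ) where
  picked : Picked n m
  current : Option (Fin m × Finset (Fin n))
  pass : ℕ

namespace GreedyMemory

variable {n m : ℕ}

/-- The partial solution after the current set has been offered. -/
noncomputable def settle (k : ℕ) (θ : ℕ → ℝ) (s : GreedyMemory n m) : Picked n m :=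
  match s.current with
  | none => s.picked
  | some (i, E) => s.picked.offer k (θ s.pass) E i

/-- Threshold greedy on the sampled elements `R`, with threshold `θ r` in pass `r`. A set is
offered when the next set begins or the pass ends. -/
noncomputable def step (R : Finset (Fin n)) (k : ℕ) (θ : ℕ → ℝ) (s : GreedyMemory n m) :
    SetToken n m → GreedyMemory n m
  | .set i => ⟨s.settle k θ, some (i, ∅), s.pass⟩
  | .elem e => ⟨s.picked, s.current.map fun x => (x.1, x.2 ∪ ({e} ∩ R)), s.pass⟩
  | .endOfPass => ⟨s.settle k θ, none, s.pass + 1⟩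

/-- The memory respects the bounds on the number of stored elements, picked sets and passes. -/
def Fits (K k N : ℕ) (s : GreedyMemory n m) : Prop :=
  s.picked.cov.card ≤ K ∧ s.picked.sol.card ≤ k ∧
    (∀ i E, s.current = some (i, E) → E.card ≤ K) ∧ s.pass ≤ N

end GreedyMemory

/-- All states on the way of a deterministic automaton that reads a list satisfy a predicate. -/
def HoldsAlong {α β : Type*} (f : α → β → α) (P : α → Prop) : α → List β → Prop
  | s, [] => P s
  | s, t :: l => P s ∧ HoldsAlong f P (f s t) l

theorem HoldsAlong.append {α β : Type*} {f : α → β → α} {P : α → Prop} {s : α} {l l' : List β}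
    (h : HoldsAlong f P s l) (h' : HoldsAlong f P (l.foldl f s) l') :
    HoldsAlong f P s (l ++ l') := by
  induction l generalizing s with
  | nil => exact h'
  | cons t l ih => exact ⟨h.1, ih h.2 h'⟩

namespace GreedyMemory

variable {n m : ℕ} {L : Fin m → List (Fin n)} {R : Finset (Fin n)} {k K N : ℕ} {θ : ℕ → ℝ}

theorem foldl_elem (p : Picked n m) (i : Fin m) (E : Finset (Fin n)) (r : ℕ)
    (l : List (Fin n)) :
    (l.map SetToken.elem).foldl (step R k θ) ⟨p, some (i, E), r⟩ =
      ⟨p, some (i, E ∪ (l.toFinset ∩ R)), r⟩ := by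
  induction l generalizing E with
  | nil => simp
  | cons e l ih =>
    have h : E ∪ ((e :: l).toFinset ∩ R) = (E ∪ ({e} ∩ R)) ∪ (l.toFinset ∩ R) := by
      ext a
      simp only [Finset.mem_union, Finset.mem_inter, List.mem_toFinset, List.mem_cons,
        Finset.mem_singleton]
      tauto
    rw [List.map_cons, List.foldl_cons, h]
    exact ih _

theorem holdsAlong_elem {p : Picked n m} {i : Fin m} {E : Finset (Fin n)} {r : ℕ}
    {l : List (Fin n)} (hp : p.cov.card ≤ K) (hs : p.sol.card ≤ k) (hr : r ≤ N)
    (hE : (E ∪ (l.toFinset ∩ R)).card ≤ K) :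
    HoldsAlong (step R k θ) (Fits K k N) ⟨p, some (i, E), r⟩ (l.map SetToken.elem) := by
  have h0 : ∀ E : Finset (Fin n), E.card ≤ K →
      Fits K k N (⟨p, some (i, E), r⟩ : GreedyMemory n m) := by
    intro E hE
    refine ⟨hp, hs, ?_, hr⟩
    rintro i' E' h
    cases h
    exact hE
  induction l generalizing E with
  | nil => exact h0 E ((Finset.card_le_card Finset.subset_union_left).trans hE)
  | cons e l ih =>
    have h : E ∪ ((e :: l).toFinset ∩ R) = (E ∪ ({e} ∩ R)) ∪ (l.toFinset ∩ R) := by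
      ext a
      simp only [Finset.mem_union, Finset.mem_inter, List.mem_toFinset, List.mem_cons,
        Finset.mem_singleton]
      tauto
    refine ⟨h0 E ((Finset.card_le_card Finset.subset_union_left).trans hE), ?_⟩
    exact ih (by rw [← h]; exact hE)

/-- Between two sets: the partial solution is valid, and the current set has been read to its
end. -/
def AtBoundary (D : Fin m → Finset (Fin n)) (k : ℕ) (s : GreedyMemory n m) : Prop :=
  s.picked.Valid D k ∧ ∀ i E, s.current = some (i, E) → E = D i

theorem AtBoundary.settle {D : Fin m → Finset (Fin n)} {s : GreedyMemory n m}
    (hs : s.AtBoundary D k) : (s.settle k θ).Valid D k := by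
  obtain ⟨p, c, r⟩ := s
  rcases c with _ | ⟨i, E⟩
  · exact hs.1
  · rw [hs.2 i E rfl]
    exact hs.1.offer _ i

theorem AtBoundary.fits {D : Fin m → Finset (Fin n)} {s : GreedyMemory n m}
    (hs : s.AtBoundary D k) (hk : 0 < k) (hr : s.pass ≤ N)
    (hK : ∀ I : Finset (Fin m), I.card ≤ k → (I.biUnion D).card ≤ K) : s.Fits K k N := by
  refine ⟨?_, hs.1.2, fun i E h => ?_, hr⟩
  · rw [hs.1.1]; exact hK _ hs.1.2
  · rw [hs.2 i E h]
    simpa using hK {i} ((Finset.card_singleton i).le.trans hk)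

/-- Reading the sets of a list offers them one after the other; the last one remains to be offered,
which `settle` takes into account. -/
theorem foldl_sets (s : GreedyMemory n m) (l : List (Fin m))
    (hs : s.AtBoundary (fun i => (L i).toFinset ∩ R) k) :
    ((l.flatMap fun i => SetToken.set i :: (L i).map SetToken.elem).foldl (step R k θ) s).AtBoundary
        (fun i => (L i).toFinset ∩ R) k ∧
    ((l.flatMap fun i => SetToken.set i :: (L i).map SetToken.elem).foldl (step R k θ) s).pass =
        s.pass ∧
    ((l.flatMap fun i => SetToken.set i :: (L i).map SetToken.elem).foldl (step R k θ) s).settle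
        k θ = l.foldl (fun p i => p.offer k (θ s.pass) ((L i).toFinset ∩ R) i) (s.settle k θ) := by
  induction l generalizing s with
  | nil => exact ⟨hs, rfl, rfl⟩
  | cons i l ih =>
    simp only [List.flatMap_cons, List.foldl_append, List.foldl_cons]
    have h : ((L i).map SetToken.elem).foldl (step R k θ) (step R k θ s (SetToken.set i)) =
        ⟨s.settle k θ, some (i, (L i).toFinset ∩ R), s.pass⟩ := by
      rw [step, foldl_elem, Finset.empty_union]
    rw [h]
    refine ih ⟨s.settle k θ, some (i, (L i).toFinset ∩ R), s.pass⟩ ⟨hs.settle, ?_⟩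
    rintro i' E' h
    cases h
    rfl

theorem holdsAlong_sets (s : GreedyMemory n m) (l : List (Fin m)) (hk : 0 < k)
    (hs : s.AtBoundary (fun i => (L i).toFinset ∩ R) k) (hr : s.pass ≤ N)
    (hK : ∀ I : Finset (Fin m), I.card ≤ k →
      (I.biUnion fun i => (L i).toFinset ∩ R).card ≤ K) :
    HoldsAlong (step R k θ) (Fits K k N) s
      (l.flatMap fun i => SetToken.set i :: (L i).map SetToken.elem) := by
  induction l generalizing s with
  | nil => exact hs.fits hk hr hK
  | cons i l ih =>
    rw [List.flatMap_cons]
    have h : ((L i).map SetToken.elem).foldl (step R k θ) (step R k θ s (SetToken.set i)) =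
        ⟨s.settle k θ, some (i, (L i).toFinset ∩ R), s.pass⟩ := by
      rw [step, foldl_elem, Finset.empty_union]
    refine HoldsAlong.append (f := step R k θ)
      (l := SetToken.set i :: (L i).map SetToken.elem)
      ⟨hs.fits hk hr hK, holdsAlong_elem ?_ hs.settle.2 hr ?_⟩ ?_
    · rw [hs.settle.1]; exact hK _ hs.settle.2
    · rw [Finset.empty_union]
      simpa using hK {i} ((Finset.card_singleton i).le.trans hk)
    · rw [List.foldl_cons, h]
      refine ih _ ⟨hs.settle, ?_⟩ hr
      rintro i' E' h
      cases h
      rfl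

theorem foldl_setStream (p : Picked n m) (r : ℕ)
    (hp : p.Valid (fun i => (L i).toFinset ∩ R) k) :
    (setStream L).foldl (step R k θ) ⟨p, none, r⟩ =
      ⟨p.pass (fun i => (L i).toFinset ∩ R) k (θ r), none, r + 1⟩ := by
  obtain ⟨-, h2, h3⟩ := foldl_sets (θ := θ) (L := L) (R := R) (k := k) ⟨p, none, r⟩
    (List.finRange m) ⟨hp, by simp⟩
  rw [setStream, List.foldl_append, List.foldl_cons, List.foldl_nil, step, h2, h3]
  rfl

theorem holdsAlong_setStream (p : Picked n m) (r : ℕ) (hk : 0 < k) (hr : r < N)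
    (hp : p.Valid (fun i => (L i).toFinset ∩ R) k)
    (hK : ∀ I : Finset (Fin m), I.card ≤ k →
      (I.biUnion fun i => (L i).toFinset ∩ R).card ≤ K) :
    HoldsAlong (step R k θ) (Fits K k N) ⟨p, none, r⟩ (setStream L) := by
  obtain ⟨h1, h2, h3⟩ := foldl_sets (θ := θ) (L := L) (R := R) (k := k) ⟨p, none, r⟩
    (List.finRange m) ⟨hp, by simp⟩
  refine (holdsAlong_sets _ _ hk ⟨hp, by simp⟩ hr.le hK).append
    ⟨h1.fits hk (h2.le.trans hr.le) hK, ?_⟩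
  have h4 : (step R k θ ((List.foldl (step R k θ) ⟨p, none, r⟩
      (List.flatMap (fun i => SetToken.set i :: List.map SetToken.elem (L i))
        (List.finRange m)))) SetToken.endOfPass).AtBoundary (fun i => (L i).toFinset ∩ R) k :=
    ⟨h1.settle, by simp [step]⟩
  refine h4.fits hk ?_ hK
  rw [step, h2]
  exact hr

/-- Reading the stream `N` times carries out `N` passes of threshold greedy on the samples. -/
theorem foldl_replicate (η w : ℝ) (N : ℕ) :
    ((List.replicate N (setStream L)).flatten).foldl
        (step R k fun r => w * (1 - η) ^ r / k) ⟨⟨∅, ∅⟩, none, 0⟩ =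
      ⟨Picked.passes (fun i => (L i).toFinset ∩ R) k η w N, none, N⟩ := by
  induction N with
  | zero => rfl
  | succ N ih =>
    rw [List.replicate_succ', List.flatten_append, List.foldl_append, ih]
    simp only [List.flatten_cons, List.flatten_nil, List.append_nil]
    exact foldl_setStream _ _ (Picked.valid_passes _ _ _ _ _)

/-- If every solution has at most `K` sampled elements, threshold greedy never needs more memory. -/
theorem holdsAlong_replicate (η w : ℝ) (hk : 0 < k)
    (hK : ∀ I : Finset (Fin m), I.card ≤ k →
      (I.biUnion fun i => (L i).toFinset ∩ R).card ≤ K) {r : ℕ} (hr : r ≤ N) :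
    HoldsAlong (step R k fun r => w * (1 - η) ^ r / k) (Fits K k N) ⟨⟨∅, ∅⟩, none, 0⟩
      (List.replicate r (setStream L)).flatten := by
  induction r with
  | zero => exact AtBoundary.fits ⟨Picked.valid_empty _ _, by simp⟩ hk (Nat.zero_le _) hK
  | succ r ih =>
    rw [List.replicate_succ', List.flatten_append]
    refine (ih (by omega)).append ?_
    rw [foldl_replicate]
    simp only [List.flatten_cons, List.flatten_nil, List.append_nil]
    exact holdsAlong_setStream _ _ hk (by omega) (Picked.valid_passes _ _ _ _ _) hK

end GreedyMemory

/-! ### Bounded memory -/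

/-- The memory contents that respect the bounds: at most `K` covered elements, at most `k` picked
sets, at most `K` elements of the current set, and at most `N` completed passes. -/
abbrev BoundedMemory (n m K k N : ℕ) : Type :=
  {E : Finset (Fin n) // E.card ≤ K} × {I : Finset (Fin m) // I.card ≤ k} ×
    Option (Fin m × {E : Finset (Fin n) // E.card ≤ K}) × Fin (N + 1)

namespace BoundedMemory

variable {n m K k N : ℕ}

/-- The memory contents of the unbounded algorithm. -/
def toGreedy (b : BoundedMemory n m K k N) : GreedyMemory n m :=
  ⟨⟨b.1.1, b.2.1.1⟩, b.2.2.1.map fun x => (x.1, x.2.1), b.2.2.2⟩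

open Classical in
/-- Store a memory contents if it respects the bounds, and abort otherwise. -/
noncomputable def store (s : GreedyMemory n m) : Option (BoundedMemory n m K k N) :=
  if h : ∃ b : BoundedMemory n m K k N, b.toGreedy = s then some h.choose else none

theorem toGreedy_of_store {s : GreedyMemory n m} {b : BoundedMemory n m K k N}
    (h : store s = some b) : b.toGreedy = s := by
  unfold store at h
  split_ifs at h with h1
  cases h
  exact h1.choose_spec

theorem exists_store {s : GreedyMemory n m} (h : s.Fits K k N) :
    ∃ b : BoundedMemory n m K k N, store s = some b := by
  have h1 : ∃ b : BoundedMemory n m K k N, b.toGreedy = s := by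
    obtain ⟨⟨p, q⟩, c, r⟩ := s
    obtain ⟨hp, hq, hc, hr⟩ := h
    rcases c with _ | ⟨i, E⟩
    · exact ⟨(⟨p, hp⟩, ⟨q, hq⟩, none, ⟨r, Nat.lt_succ_of_le hr⟩), rfl⟩
    · exact ⟨(⟨p, hp⟩, ⟨q, hq⟩, some (i, ⟨E, hc i E rfl⟩), ⟨r, Nat.lt_succ_of_le hr⟩), rfl⟩
  exact ⟨h1.choose, dif_pos h1⟩

/-- Threshold greedy that aborts, for good, when its memory overflows. -/
noncomputable def step (R : Finset (Fin n)) (θ : ℕ → ℝ) (o : Option (BoundedMemory n m K k N))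
    (t : SetToken n m) : Option (BoundedMemory n m K k N) :=
  o.bind fun b => store (b.toGreedy.step R k θ t)

theorem foldl_step_none (R : Finset (Fin n)) (θ : ℕ → ℝ) (l : List (SetToken n m)) :
    l.foldl (step R θ) (none : Option (BoundedMemory n m K k N)) = none := by
  induction l with
  | nil => rfl
  | cons t l ih => exact ih

theorem toGreedy_of_foldl {R : Finset (Fin n)} {θ : ℕ → ℝ} {l : List (SetToken n m)}
    {s : GreedyMemory n m} {b : BoundedMemory n m K k N}
    (h : l.foldl (step R θ) (store s) = some b) :
    b.toGreedy = l.foldl (GreedyMemory.step R k θ) s := by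
  induction l generalizing s with
  | nil => exact toGreedy_of_store h
  | cons t l ih =>
    rcases hs : (store s : Option (BoundedMemory n m K k N)) with _ | b'
    · rw [hs, foldl_step_none] at h
      cases h
    · rw [hs, List.foldl_cons, step, Option.bind_some, toGreedy_of_store hs] at h
      exact ih h

theorem exists_foldl {R : Finset (Fin n)} {θ : ℕ → ℝ} {l : List (SetToken n m)}
    {s : GreedyMemory n m}
    (h : HoldsAlong (GreedyMemory.step R k θ) (GreedyMemory.Fits K k N) s l) :
    ∃ b : BoundedMemory n m K k N, l.foldl (step R θ) (store s) = some b := by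
  induction l generalizing s with
  | nil => exact exists_store h
  | cons t l ih =>
    obtain ⟨b', hb'⟩ : ∃ b : BoundedMemory n m K k N, store s = some b := exists_store h.1
    rw [hb', List.foldl_cons, step, Option.bind_some, toGreedy_of_store hb']
    exact ih h.2

/-- The identifiers picked, none if the run was aborted. -/
def answer (o : Option (BoundedMemory n m K k N)) : Finset (Fin m) :=
  o.elim ∅ fun b => b.2.1.1

/-- The estimated coverage of the answer minus the sampling error, if one of `Q` elements is sampled
and the guess for the optimum is `v`. An aborted run has value zero, the coverage of its empty
answer. -/
noncomputable def value (Q η v : ℝ) (o : Option (BoundedMemory n m K k N)) : ℝ :=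
  o.elim 0 fun b => Q * b.1.1.card - η * v

theorem card_answer_le (o : Option (BoundedMemory n m K k N)) : (answer o).card ≤ k := by
  rcases o with _ | b
  · exact Nat.zero_le _
  · exact b.2.1.2

theorem card_option_le (n m K k N : ℕ) :
    Fintype.card (Option (BoundedMemory n m K k N)) ≤
      (n + 1) ^ (2 * K) * (m + 1) ^ (k + 1) * (N + 2) := by
  have h1 := card_finset_card_le (Fin n) K
  have h2 := card_finset_card_le (Fin m) k
  rw [Fintype.card_fin] at h1 h2
  have h3 : 0 < (n + 1) ^ K := by positivity
  have h4 : 0 < (m + 1) ^ k := by positivity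
  rw [Fintype.card_option, Fintype.card_prod, Fintype.card_prod, Fintype.card_prod,
    Fintype.card_option, Fintype.card_prod, Fintype.card_fin, Fintype.card_fin]
  calc _ ≤ (n + 1) ^ K * ((m + 1) ^ k * ((m * (n + 1) ^ K + (n + 1) ^ K) * (N + 1))) +
        (n + 1) ^ K * ((m + 1) ^ k * (m * (n + 1) ^ K + (n + 1) ^ K)) := by
        refine Nat.add_le_add ?_ (Nat.succ_le_of_lt (by positivity))
        gcongr
        omega
    _ = _ := by ring

end BoundedMemory

/-! ### The run for one guess of the optimum -/

/-- For the guess `v = 2 ^ j` of the optimum, one of `rate K j + 1 = ⌊v / K⌋ + 1` elements is sampled.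
So `v` elements contain at most `K` sampled ones on average, and at least `K / 2` unless every element
is sampled. -/
def rate (K j : ℕ) : ℕ := 2 ^ j / K

theorem two_pow_div_rate_le {K : ℕ} (hK : 0 < K) (j : ℕ) :
    (2 : ℝ) ^ j / ((rate K j + 1 : ℕ) : ℝ) ≤ K := by
  rw [div_le_iff₀ (by positivity)]
  have := (Nat.div_lt_iff_lt_mul hK).1 (Nat.lt_succ_self (2 ^ j / K))
  rw [mul_comm]
  exact_mod_cast this.le

theorem le_two_pow_div_rate {K j : ℕ} (hr : rate K j ≠ 0) :
    (K : ℝ) / 2 ≤ (2 : ℝ) ^ j / ((rate K j + 1 : ℕ) : ℝ) := by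
  rw [le_div_iff₀ (by positivity)]
  have h1 : rate K j * K ≤ 2 ^ j := Nat.div_mul_le_self _ _
  have h2 : (rate K j + 1) * K ≤ 2 * 2 ^ j := by
    have : 1 ≤ rate K j := Nat.one_le_iff_ne_zero.2 hr
    nlinarith
  have h3 : ((rate K j + 1 : ℕ) : ℝ) * K ≤ 2 * 2 ^ j := by exact_mod_cast h2
  linarith

/-- The threshold of the `r`-th pass for the guess `2 ^ j` of the optimum. -/
noncomputable def threshold (K k : ℕ) (η : ℝ) (j r : ℕ) : ℝ :=
  (2 : ℝ) ^ j / ((rate K j + 1 : ℕ) : ℝ) * (1 - η) ^ r / k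

/-- The state of the run for the guess `2 ^ j` after reading `l`, if `h` is the sampling function. -/
noncomputable def guessRun {n m : ℕ} (K k N : ℕ) (η : ℝ) (j : ℕ) (h : Fin n → Fin (rate K j + 1))
    (l : List (SetToken n m)) : Option (BoundedMemory n m K k N) :=
  l.foldl (BoundedMemory.step (Finset.univ.filter fun e => h e = 0) (threshold K k η j))
    (BoundedMemory.store ⟨⟨∅, ∅⟩, none, 0⟩)

section guessRun

variable {n m K k N j : ℕ} {η : ℝ} {h : Fin n → Fin (rate K j + 1)} {L : Fin m → List (Fin n)}

theorem biUnion_sample (h : Fin n → Fin (rate K j + 1)) (L : Fin m → List (Fin n))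
    (I : Finset (Fin m)) :
    (I.biUnion fun i => (L i).toFinset ∩ Finset.univ.filter fun e => h e = 0) =
      (I.biUnion fun i => (L i).toFinset).filter fun e => h e = 0 := by
  ext e
  simp only [Finset.mem_biUnion, Finset.mem_inter, Finset.mem_filter, Finset.mem_univ, true_and]
  constructor
  · rintro ⟨i, hi, h1, h2⟩; exact ⟨⟨i, hi, h1⟩, h2⟩
  · rintro ⟨⟨i, hi, h1⟩, h2⟩; exact ⟨i, hi, h1, h2⟩

theorem abs_sample_sub_le (hh : h ∉ badSamples k (rate K j) η (2 ^ j) fun i => (L i).toFinset)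
    {I : Finset (Fin m)} (hI : I.card ≤ k) :
    |((rate K j + 1 : ℕ) : ℝ) * (I.biUnion fun i => (L i).toFinset ∩
      Finset.univ.filter fun e => h e = 0).card - coverage L I| ≤
        η * max ((2 : ℝ) ^ j) (coverage L I) := by
  classical
  rw [biUnion_sample]
  by_contra hcon
  exact hh (by
    simp only [badSamples, Finset.mem_filter, Finset.mem_univ, true_and]
    exact ⟨I, hI, not_le.1 hcon⟩)

theorem coverage_le_optCoverage {I : Finset (Fin m)} (hI : I.card ≤ k) :
    coverage L I ≤ optCoverage L k :=
  Finset.le_sup (f := coverage L) (by simpa using hI)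

/-- Whatever the guess, the value overestimates the coverage by a factor of at most `1 + η`. -/
theorem value_guessRun_le (hη : 0 ≤ η)
    (hh : h ∉ badSamples k (rate K j) η (2 ^ j) fun i => (L i).toFinset) :
    BoundedMemory.value ((rate K j + 1 : ℕ) : ℝ) η (2 ^ j)
      (guessRun K k N η j h (List.replicate N (setStream L)).flatten) ≤
    (1 + η) * coverage L (BoundedMemory.answer
      (guessRun K k N η j h (List.replicate N (setStream L)).flatten)) := by
  rcases hb : guessRun K k N η j h (List.replicate N (setStream L)).flatten with _ | b
  · simp only [BoundedMemory.value, Option.elim_none]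
    positivity
  · have h1 := (BoundedMemory.toGreedy_of_foldl hb).trans (GreedyMemory.foldl_replicate _ _ _)
    have h2 : b.1.1 = b.2.1.1.biUnion fun i => (L i).toFinset ∩
        Finset.univ.filter fun e => h e = 0 := by
      have h3 : b.toGreedy.picked.Valid (fun i => (L i).toFinset ∩
          Finset.univ.filter fun e => h e = 0) k := by
        rw [h1]
        exact Picked.valid_passes _ _ _ _ _
      exact h3.1
    have h4 := abs_sample_sub_le hh b.2.1.2
    rw [← h2] at h4
    have h5 := (abs_le.1 h4).2
    simp only [BoundedMemory.value, BoundedMemory.answer, Option.elim_some]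
    have h6 : max ((2 : ℝ) ^ j) (coverage L b.2.1.1) ≤ 2 ^ j + coverage L b.2.1.1 :=
      max_le_add_of_nonneg (by positivity) (by positivity)
    nlinarith

/-- If the guess for the optimum is correct up to constant factors, the run is not aborted and its
value is large. -/
theorem le_value_guessRun (hk : 0 < k) (hK : 0 < K) (hη : 0 < η) (hη1 : η ≤ 1 / 10)
    (hN : 4 / η ≤ N)
    (hh : h ∉ badSamples k (rate K j) η (2 ^ j) fun i => (L i).toFinset)
    (h1 : 2 * optCoverage L k ≤ 2 ^ j) (h2 : 2 ^ j ≤ 4 * optCoverage L k) :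
    (1 - 1 / Real.exp 1 - 9 * η) * optCoverage L k ≤
    BoundedMemory.value ((rate K j + 1 : ℕ) : ℝ) η (2 ^ j)
      (guessRun K k (N + 1) η j h (List.replicate (N + 1) (setStream L)).flatten) := by
  obtain ⟨O, hO, hOeq⟩ := Finset.exists_mem_eq_sup
    (Finset.univ.filter fun I : Finset (Fin m) => I.card ≤ k) ⟨∅, by simp⟩ (coverage L)
  replace hO : O.card ≤ k := by simpa using hO
  change optCoverage L k = coverage L O at hOeq
  have h1' : 2 * (optCoverage L k : ℝ) ≤ 2 ^ j := by exact_mod_cast h1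
  have h2' : (2 : ℝ) ^ j ≤ 4 * (optCoverage L k : ℝ) := by exact_mod_cast h2
  have hQ : (0 : ℝ) < ((rate K j + 1 : ℕ) : ℝ) := by positivity
  have hv : (0 : ℝ) < 2 ^ j := by positivity
  set v : ℝ := 2 ^ j
  set opt : ℝ := ((optCoverage L k : ℕ) : ℝ)
  have hw0 := two_pow_div_rate_le hK j
  set Q : ℝ := ((rate K j + 1 : ℕ) : ℝ)
  have hcov : ∀ I : Finset (Fin m), I.card ≤ k → (coverage L I : ℝ) ≤ opt := fun I hI =>
    Nat.cast_le.2 (coverage_le_optCoverage hI)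
  have hest : ∀ I : Finset (Fin m), I.card ≤ k →
      |Q * (I.biUnion fun i => (L i).toFinset ∩
      Finset.univ.filter fun e => h e = 0).card - coverage L I| ≤ η * v := by
    intro I hI
    have h3 := abs_sample_sub_le hh hI
    rwa [max_eq_left (by linarith [hcov I hI])] at h3
  have hsize : ∀ I : Finset (Fin m), I.card ≤ k →
      ((I.biUnion fun i => (L i).toFinset ∩
      Finset.univ.filter fun e => h e = 0).card : ℝ) ≤ v / Q := by
    intro I hI
    rw [le_div_iff₀ hQ, mul_comm]
    nlinarith [(abs_le.1 (hest I hI)).2, hcov I hI]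
  obtain ⟨b, hb⟩ : ∃ b : BoundedMemory n m K k (N + 1),
      guessRun K k (N + 1) η j h (List.replicate (N + 1) (setStream L)).flatten = some b := by
    refine BoundedMemory.exists_foldl (GreedyMemory.holdsAlong_replicate η (v / Q) hk ?_ le_rfl)
    intro I hI
    exact_mod_cast (hsize I hI).trans hw0
  have h4 := (BoundedMemory.toGreedy_of_foldl hb).trans (GreedyMemory.foldl_replicate _ _ _)
  have h5 := congrArg (fun s => s.picked.cov) h4
  change b.1.1 = _ at h5
  rw [hb, BoundedMemory.value, Option.elim_some, h5]
  have hx := abs_le.1 (hest O hO)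
  rw [← hOeq] at hx
  have h6 := Picked.card_cov_passes_ge (η := η) (w := v / Q) hO hk hη (by linarith)
    (by positivity) (hsize O hO) (by
      rw [div_le_iff₀ hQ]
      nlinarith [hx.1]) hN
  set x : ℝ := ((O.biUnion fun i => (L i).toFinset ∩
      Finset.univ.filter fun e => h e = 0).card : ℝ)
  have he0 : 0 < 1 / Real.exp 1 := by positivity
  have he1 : 1 / Real.exp 1 ≤ 1 / 2 :=
    one_div_le_one_div_of_le (by norm_num) (by linarith [Real.exp_one_gt_d9])
  have h7 := mul_le_mul_of_nonneg_left h6 hQ.le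
  have h8 : (1 - 1 / Real.exp 1 - η) * (opt - η * v) ≤ (1 - 1 / Real.exp 1 - η) * (Q * x) :=
    mul_le_mul_of_nonneg_left (by linarith [hx.1]) (by linarith)
  have h9 : (1 - 1 / Real.exp 1 - η) * (η * v) ≤ 1 * (η * v) :=
    mul_le_mul_of_nonneg_right (by linarith) (by positivity)
  have h10 : η * v ≤ η * (4 * opt) := mul_le_mul_of_nonneg_left h2' hη.le
  have h11 : Q * ((1 - 1 / Real.exp 1 - η) * x) = (1 - 1 / Real.exp 1 - η) * (Q * x) := by ring
  rw [h11] at h7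
  refine le_trans ?_ (sub_le_sub_right (h8.trans h7) _)
  linarith

end guessRun

/-! ### Choosing among the guesses -/

/-- The index of a largest value. -/
noncomputable def bestIndex {J : ℕ} (f : Fin (J + 1) → ℝ) : Fin (J + 1) :=
  (Finite.exists_max f).choose

theorem le_bestIndex {J : ℕ} (f : Fin (J + 1) → ℝ) (j : Fin (J + 1)) : f j ≤ f (bestIndex f) :=
  (Finite.exists_max f).choose_spec j

/-- The answer for the guess of largest value. -/
noncomputable def bestAnswer {n m K k N J : ℕ} (η : ℝ)
    (g : Fin (J + 1) → Option (BoundedMemory n m K k N)) : Finset (Fin m) :=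
  BoundedMemory.answer (g (bestIndex fun j =>
    BoundedMemory.value ((rate K j + 1 : ℕ) : ℝ) η (2 ^ (j : ℕ)) (g j)))

theorem bestAnswer_guessRun {n m K k N J : ℕ} {η : ℝ} {L : Fin m → List (Fin n)}
    (hk : 0 < k) (hK : 0 < K) (hη : 0 < η) (hη1 : η ≤ 1 / 10) (hN : 4 / η ≤ N)
    (hJ : Nat.log 2 n + 2 ≤ J) (h : ∀ j : Fin (J + 1), Fin n → Fin (rate K j + 1))
    (hh : ∀ j : Fin (J + 1), h j ∉ badSamples k (rate K j) η (2 ^ (j : ℕ)) fun i => (L i).toFinset) :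
    (1 - 1 / Real.exp 1 - 10 * η) * optCoverage L k ≤
      coverage L (bestAnswer η fun j : Fin (J + 1) => guessRun K k (N + 1) η j (h j)
        (List.replicate (N + 1) (setStream L)).flatten) := by
  set g := fun j : Fin (J + 1) => guessRun K k (N + 1) η j (h j)
        (List.replicate (N + 1) (setStream L)).flatten
  by_cases h0 : optCoverage L k = 0
  · rw [h0, Nat.cast_zero, mul_zero]
    positivity
  have hopt : optCoverage L k ≤ n := by
    refine Finset.sup_le fun I _ => ?_
    unfold coverage
    simpa using Finset.card_le_univ (I.biUnion fun i => (L i).toFinset)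
  have hlog : Nat.log 2 (optCoverage L k) ≤ Nat.log 2 n := Nat.log_mono_right hopt
  have h1 : 2 ^ Nat.log 2 (optCoverage L k) ≤ optCoverage L k := Nat.pow_log_le_self 2 h0
  have h2 : optCoverage L k < 2 ^ (Nat.log 2 (optCoverage L k) + 1) :=
    Nat.lt_pow_succ_log_self (by norm_num) _
  -- The right guess is the power of two in the interval `(2 * OPT, 4 * OPT]`.
  have h3 := le_value_guessRun (N := N) hk hK hη hη1 hN
    (hh ⟨Nat.log 2 (optCoverage L k) + 2, by omega⟩) (L := L)
    (by simp only [pow_succ] at h2 ⊢; omega) (by simp only [pow_succ]; omega)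
  have h4 := h3.trans (le_bestIndex (fun j => BoundedMemory.value ((rate K j + 1 : ℕ) : ℝ) η
    (2 ^ (j : ℕ)) (g j)) ⟨Nat.log 2 (optCoverage L k) + 2, by omega⟩)
  have h5 := h4.trans (value_guessRun_le (N := N + 1) hη.le (hh _))
  have h6 : (coverage L (bestAnswer η g) : ℝ) ≤ optCoverage L k := by
    exact_mod_cast coverage_le_optCoverage (BoundedMemory.card_answer_le _)
  change _ ≤ (1 + η) * (coverage L (bestAnswer η g) : ℝ) at h5
  nlinarith

/-! ### The streaming algorithm -/

theorem StreamAlg.feed_of_deterministic {Tok Out : Type} (A : StreamAlg Tok Out)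
    {f : A.State → Tok → A.State} (hf : ∀ s t, A.update s t = PMF.pure (f s t)) (s : A.State)
    (l : List Tok) : A.feed s l = PMF.pure (l.foldl f s) := by
  induction l generalizing s with
  | nil => rfl
  | cons t l ih => rw [StreamAlg.feed, hf, PMF.pure_bind, ih, List.foldl_cons]

theorem StreamAlg.run_of_deterministic {Tok Out α : Type} (A : StreamAlg Tok Out)
    {f : A.State → Tok → A.State} (hf : ∀ s t, A.update s t = PMF.pure (f s t))
    {p : PMF α} {g : α → A.State} (hp : A.init = p.map g) (l : List Tok) :
    A.run l = p.map fun a => A.output ((List.replicate A.passes l).flatten.foldl f (g a)) := by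
  have h1 : (fun s => A.feed s (List.replicate A.passes l).flatten) =
      PMF.pure ∘ fun s => (List.replicate A.passes l).flatten.foldl f s :=
    funext fun s => A.feed_of_deterministic hf s _
  rw [StreamAlg.run, hp, h1, PMF.bind_pure_comp, PMF.map_comp, PMF.map_comp]
  rfl

/-- A union bound for the uniform distribution. -/
theorem le_toOuterMeasure_uniform {J T : ℕ} (B : Fin (J + 1) → Finset (Fin (T + 1))) {δ : ℝ}
    (hB : ∀ j, ((B j).card : ℝ) ≤ δ * (T + 1 : ℕ)) {G : Set (Fin (T + 1))}
    (hG : ∀ t, (∀ j, t ∉ B j) → t ∈ G) :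
    1 - (J + 1) * δ ≤ ((PMF.uniformOfFintype (Fin (T + 1))).toOuterMeasure G).toReal := by
  classical
  rw [PMF.toOuterMeasure_uniformOfFintype_apply,
    ENNReal.toReal_div, ENNReal.toReal_natCast, ENNReal.toReal_natCast, Fintype.card_fin,
    le_div_iff₀ (by positivity)]
  have h1 : Finset.univ \ Finset.univ.biUnion B ⊆ G.toFinset := by
    intro t ht
    rw [Set.mem_toFinset]
    exact hG t fun j hj =>
      (Finset.mem_sdiff.1 ht).2 (Finset.mem_biUnion.2 ⟨j, Finset.mem_univ _, hj⟩)
  have h2 : ((Finset.univ.biUnion B).card : ℝ) ≤ (J + 1) * (δ * (T + 1 : ℕ)) := by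
    calc ((Finset.univ.biUnion B).card : ℝ) ≤ ∑ j, ((B j).card : ℝ) := by
          exact_mod_cast Finset.card_biUnion_le
      _ ≤ ∑ j : Fin (J + 1), δ * (T + 1 : ℕ) := Finset.sum_le_sum fun j _ => hB j
      _ = _ := by simp
  have h3 := Finset.card_le_card h1
  rw [Finset.card_sdiff_of_subset (Finset.subset_univ _), Set.toFinset_card, Finset.card_univ,
    Fintype.card_fin] at h3
  have h4 : T + 1 ≤ Fintype.card G + (Finset.univ.biUnion B).card := by omega
  have h5 : ((T + 1 : ℕ) : ℝ) ≤ Fintype.card G + (Finset.univ.biUnion B).card := by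
    exact_mod_cast h4
  nlinarith

theorem foldl_parallel {τ ι σ β : Type*} (F : τ → ι → σ → β → σ) (t : τ) (g : ι → σ)
    (l : List β) :
    l.foldl (fun (s : τ × (ι → σ)) b => (s.1, fun j => F s.1 j (s.2 j) b)) (t, g) =
      (t, fun j => l.foldl (F t j) (g j)) := by
  induction l generalizing g with
  | nil => rfl
  | cons b l ih => exact ih _

/-- The streaming algorithm: its memory holds the index `t` of an entry of a fixed table of
sampling functions, and the memories of the runs for all guesses of the optimum. -/
noncomputable def coverAlg {n m : ℕ} (K k N J T : ℕ) (η : ℝ)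
    (ω : ∀ j : Fin (J + 1), Fin (T + 1) → Fin n → Fin (rate K j + 1)) :
    StreamAlg (SetToken n m) (Finset (Fin m)) where
  State := Fin (T + 1) × (Fin (J + 1) → Option (BoundedMemory n m K k N))
  passes := N
  init := (PMF.uniformOfFintype (Fin (T + 1))).map fun t =>
    (t, fun _ => BoundedMemory.store ⟨⟨∅, ∅⟩, none, 0⟩)
  update s tok := PMF.pure (s.1, fun j =>
    BoundedMemory.step (Finset.univ.filter fun e => ω j s.1 e = 0) (threshold K k η j) (s.2 j) tok)
  output s := bestAnswer η s.2

section coverAlg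

variable {n m K k N J T : ℕ} {η : ℝ}
  {ω : ∀ j : Fin (J + 1), Fin (T + 1) → Fin n → Fin (rate K j + 1)}

theorem run_coverAlg (l : List (SetToken n m)) :
    (coverAlg K k N J T η ω).run l = (PMF.uniformOfFintype (Fin (T + 1))).map fun t =>
      bestAnswer η fun j : Fin (J + 1) =>
        guessRun K k N η j (ω j t) (List.replicate N l).flatten := by
  refine (StreamAlg.run_of_deterministic (coverAlg K k N J T η ω) (fun _ _ => rfl) rfl l).trans ?_
  congr 1
  funext t
  exact congrArg (fun s : Fin (T + 1) × (Fin (J + 1) → Option (BoundedMemory n m K k N)) =>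
    bestAnswer η s.2) (foldl_parallel (fun (t : Fin (T + 1)) (j : Fin (J + 1)) =>
      BoundedMemory.step (Finset.univ.filter fun e => ω j t e = 0) (threshold K k η j)) t _
        (List.replicate N l).flatten)

theorem le_run_coverAlg {L : Fin m → List (Fin n)} {δ : ℝ}
    (hk : 0 < k) (hK : 0 < K) (hη : 0 < η) (hη1 : η ≤ 1 / 10) (hN : 4 / η ≤ N)
    (hJ : Nat.log 2 n + 2 ≤ J)
    (hω : ∀ j : Fin (J + 1), ((Finset.univ.filter fun t => ω j t ∈
      badSamples k (rate K j) η (2 ^ (j : ℕ)) fun i => (L i).toFinset).card : ℝ) ≤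
        δ * (T + 1 : ℕ)) :
    1 - (J + 1) * δ ≤ (((coverAlg K k (N + 1) J T η ω).run (setStream L)).toOuterMeasure
      {I | I.card ≤ k ∧
        (1 - 1 / Real.exp 1 - 10 * η) * (optCoverage L k : ℝ) ≤ (coverage L I : ℝ)}).toReal := by
  set B : Fin (J + 1) → Finset (Fin (T + 1)) := fun j => Finset.univ.filter fun t =>
    ω j t ∈ badSamples k (rate K j) η (2 ^ (j : ℕ)) fun i => (L i).toFinset with hB
  rw [run_coverAlg, PMF.toOuterMeasure_map_apply]
  refine le_toOuterMeasure_uniform B hω fun t ht => ⟨BoundedMemory.card_answer_le _, ?_⟩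
  refine bestAnswer_guessRun hk hK hη hη1 hN hJ (fun j => ω j t)
    fun (j : Fin (J + 1)) hj => ht j ?_
  exact Finset.mem_filter.2 ⟨Finset.mem_univ _, hj⟩

theorem space_coverAlg_le :
    ((coverAlg K k N J T η ω : StreamAlg (SetToken n m) _).space : ℝ) ≤
      2 * (Real.log (T + 1) + (J + 1) * (2 * K * Real.log (n + 1) + (k + 1) * Real.log (m + 1) +
        Real.log (N + 2))) + 1 := by
  have h1 : (coverAlg K k N J T η ω : StreamAlg (SetToken n m) _).space =
      Nat.clog 2 ((T + 1) * Fintype.card (Option (BoundedMemory n m K k N)) ^ (J + 1)) := by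
    change Nat.clog 2 (Fintype.card
      (Fin (T + 1) × (Fin (J + 1) → Option (BoundedMemory n m K k N)))) = _
    rw [Fintype.card_prod, Fintype.card_fun, Fintype.card_fin, Fintype.card_fin]
  set M := (T + 1) * ((n + 1) ^ (2 * K) * (m + 1) ^ (k + 1) * (N + 2)) ^ (J + 1) with hM
  have h2 : (coverAlg K k N J T η ω : StreamAlg (SetToken n m) _).space ≤ Nat.log 2 M + 1 := by
    rw [h1]
    refine (Nat.clog_mono_right 2 (Nat.mul_le_mul_left _
      (Nat.pow_le_pow_left (BoundedMemory.card_option_le n m K k N) _))).trans ?_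
    exact Nat.clog_le_of_le_pow (Nat.lt_pow_succ_log_self (by norm_num) _).le
  have hM0 : M ≠ 0 := by positivity
  have h3 : (Nat.log 2 M : ℝ) * Real.log 2 ≤ Real.log M := by
    rw [← Real.log_pow]
    refine Real.log_le_log (by positivity) ?_
    exact_mod_cast Nat.pow_log_le_self 2 hM0
  have h4 : Real.log M = Real.log (T + 1) + (J + 1) * (2 * K * Real.log (n + 1) +
      (k + 1) * Real.log (m + 1) + Real.log (N + 2)) := by
    rw [hM]
    push_cast
    rw [Real.log_mul (by positivity) (by positivity), Real.log_pow,
      Real.log_mul (by positivity) (by positivity), Real.log_mul (by positivity) (by positivity),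
      Real.log_pow, Real.log_pow]
    push_cast
    ring
  rw [← h4]
  have h5 : ((coverAlg K k N J T η ω : StreamAlg (SetToken n m) _).space : ℝ) ≤
      Nat.log 2 M + 1 := by exact_mod_cast h2
  have h6 : (0 : ℝ) ≤ Nat.log 2 M := by positivity
  nlinarith [Real.log_two_gt_d9]

end coverAlg

/-! ### The choice of the parameters -/

theorem card_badSamples_le_of_le {n m k q K : ℕ} {η v M : ℝ} (hη : 0 < η) (hη1 : η ≤ 1)
    (hv : 0 ≤ v) (hM : 0 < M) (hq : q = 0 ∨ (K : ℝ) / 2 ≤ v / ((q + 1 : ℕ) : ℝ))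
    (hK : 8 / η ^ 2 * Real.log (8 * (m + 1) ^ k * M) ≤ K) (S : Fin m → Finset (Fin n)) :
    ((badSamples k q η v S).card : ℝ) ≤ 1 / M / 4 * Fintype.card (Fin n → Fin (q + 1)) := by
  rcases hq with rfl | hq
  · rw [badSamples_zero k hη.le hv]
    simp only [Finset.card_empty, Nat.cast_zero]
    positivity
  refine (card_badSamples_le k q hη hη1 S).trans ?_
  rw [← mul_assoc]
  refine mul_le_mul_of_nonneg_right ?_ (by positivity)
  have hX : (0 : ℝ) < 8 * (m + 1) ^ k * M := by positivity
  have h1 : Real.log (8 * (m + 1) ^ k * M) ≤ η ^ 2 * v / (4 * ((q + 1 : ℕ) : ℝ)) := by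
    have h2 : η ^ 2 * v / (4 * ((q + 1 : ℕ) : ℝ)) = η ^ 2 / 4 * (v / ((q + 1 : ℕ) : ℝ)) := by
      field_simp
    have h3 : Real.log (8 * (m + 1) ^ k * M) =
        η ^ 2 / 8 * (8 / η ^ 2 * Real.log (8 * (m + 1) ^ k * M)) := by field_simp
    rw [h2, h3]
    calc _ ≤ η ^ 2 / 8 * (K : ℝ) := by gcongr
      _ = η ^ 2 / 4 * ((K : ℝ) / 2) := by ring
      _ ≤ _ := by gcongr
  have h4 : Real.exp (-(η ^ 2 * v / (4 * ((q + 1 : ℕ) : ℝ)))) ≤ 1 / (8 * (m + 1) ^ k * M) := by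
    rw [Real.exp_neg, ← one_div]
    refine one_div_le_one_div_of_le hX ?_
    calc _ = Real.exp (Real.log (8 * (m + 1) ^ k * M)) := (Real.exp_log hX).symm
      _ ≤ _ := Real.exp_le_exp.2 h1
  calc ((m : ℝ) + 1) ^ k * (2 * Real.exp (-(η ^ 2 * v / (4 * ((q + 1 : ℕ) : ℝ)))))
      ≤ ((m : ℝ) + 1) ^ k * (2 * (1 / (8 * (m + 1) ^ k * M))) := by gcongr
    _ = 1 / M / 4 := by field_simp; norm_num

/-- A polynomially large table of sampling functions serves all inputs. -/
theorem exists_sampling_tables {n m k K J T : ℕ} {η M : ℝ} (hn : 0 < n) (hm : 0 < m)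
    (hη : 0 < η) (hη1 : η ≤ 1) (hM : 0 < M)
    (hK : 8 / η ^ 2 * Real.log (8 * (m + 1) ^ k * M) ≤ K) (hT : 2 * (n * m) * M ≤ T) :
    ∃ ω : ∀ j : Fin (J + 1), Fin (T + 1) → Fin n → Fin (rate K j + 1),
      ∀ (j : Fin (J + 1)) (S : Fin m → Finset (Fin n)),
        ((Finset.univ.filter fun t => ω j t ∈
          badSamples k (rate K j) η (2 ^ (j : ℕ)) S).card : ℝ) ≤ 1 / M * (T + 1 : ℕ) := by
  have h : ∀ j : Fin (J + 1), ∃ ω : Fin (T + 1) → Fin n → Fin (rate K j + 1),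
      ∀ S : Fin m → Finset (Fin n), ((Finset.univ.filter fun t => ω t ∈
          badSamples k (rate K j) η (2 ^ (j : ℕ)) S).card : ℝ) ≤ 1 / M * (T + 1 : ℕ) := by
    intro j
    refine exists_table (fun S => badSamples k (rate K j) η (2 ^ (j : ℕ)) S)
      (Nat.mul_pos hn hm) ?_ ?_ fun S => card_badSamples_le_of_le hη hη1 (by positivity) hM ?_ hK S
    · simp [← pow_mul]
    · rw [one_div, ← div_eq_inv_mul, le_div_iff₀ hM]
      push_cast
      linarith
    · rcases eq_or_ne (rate K j) 0 with h0 | h0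
      · exact Or.inl h0
      · exact Or.inr (le_two_pow_div_rate h0)
  choose ω hω using h
  exact ⟨ω, hω⟩

theorem log_add_one_le_log {a b : ℝ} (ha : 1 ≤ a) (hab : 2 * a ≤ b) :
    Real.log (a + 1) ≤ Real.log b :=
  Real.log_le_log (by linarith) (by linarith)

/-- The total of the space bound, if all logarithms are bounded by multiples of `Λ`. -/
theorem space_bound_le {c κ a Λ t j K k x y z : ℝ} (hc : 0 ≤ c) (ha : 1 ≤ a) (hΛ : 1 / 2 ≤ Λ)
    (ht : t ≤ (c + 11) * Λ) (hj : j ≤ 8 * Λ) (hK : K ≤ κ * (a * Λ)) (hK0 : 0 ≤ K)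
    (hk : k ≤ a) (hk0 : 0 ≤ k) (hx0 : 0 ≤ x) (hx : x ≤ Λ) (hy0 : 0 ≤ y) (hy : y ≤ Λ)
    (hz0 : 0 ≤ z) (hz : z ≤ 7 * Λ) :
    2 * (t + j * (2 * K * x + (k + 1) * y + z)) + 1 ≤
      (2 * (4 * (c + 11) + 16 * κ + 200) + 8) * a * Λ ^ 3 := by
  have h1 : 2 * K * x ≤ 2 * (κ * (a * Λ)) * Λ :=
    mul_le_mul (by linarith) hx hx0 (by linarith)
  have h2 : (k + 1) * y ≤ (2 * a) * Λ := mul_le_mul (by linarith) hy hy0 (by positivity)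
  have h3 : j * (2 * K * x + (k + 1) * y + z) ≤
      8 * Λ * (2 * (κ * (a * Λ)) * Λ + 2 * a * Λ + 7 * Λ) :=
    mul_le_mul hj (by linarith) (by positivity) (by positivity)
  have h4 : Λ ^ 2 ≤ 2 * Λ ^ 3 := by nlinarith [sq_nonneg Λ]
  have h5 : Λ ≤ 4 * Λ ^ 3 := by nlinarith
  have h7 : 0 ≤ Λ ^ 3 := by positivity
  have h8 : Λ ^ 3 ≤ a * Λ ^ 3 := le_mul_of_one_le_left h7 ha
  have h9 : a * Λ ^ 2 ≤ a * (2 * Λ ^ 3) := mul_le_mul_of_nonneg_left h4 (by linarith)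
  have h10 : (c + 11) * Λ ≤ (c + 11) * (4 * (a * Λ ^ 3)) :=
    mul_le_mul_of_nonneg_left (by linarith) (by positivity)
  have h6 : 1 ≤ 8 * Λ ^ 3 := by linarith
  calc _ ≤ 2 * ((c + 11) * Λ + 8 * Λ * (2 * (κ * (a * Λ)) * Λ + 2 * a * Λ + 7 * Λ)) + 1 := by
        linarith
    _ = 2 * ((c + 11) * Λ + 16 * κ * (a * Λ ^ 3) + 16 * (a * Λ ^ 2) + 56 * Λ ^ 2) + 1 := by
        ring
    _ ≤ 2 * ((c + 11) * (4 * (a * Λ ^ 3)) + 16 * κ * (a * Λ ^ 3) + 32 * (a * Λ ^ 3) +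
        112 * (a * Λ ^ 3)) + 8 * (a * Λ ^ 3) := by linarith
    _ ≤ 2 * ((c + 11) * (4 * (a * Λ ^ 3)) + 16 * κ * (a * Λ ^ 3) + 200 * (a * Λ ^ 3)) +
        8 * (a * Λ ^ 3) := by linarith
    _ = _ := by ring

set_option maxHeartbeats 800000 in
/-- The bookkeeping for the space: the size `K` of the samples is `O(k Λ / ε ^ 2)`, there are `O(Λ)`
guesses, and the table has `exp (O(Λ))` entries. -/
theorem exists_coverAlg (c : ℕ) : ∃ C : ℝ, ∀ (n m k : ℕ) (ε : ℝ), 0 < n → 0 < m → 0 < k → 0 < ε →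
    ε < 1 → ∃ A : StreamAlg (SetToken n m) (Finset (Fin m)),
      (A.passes : ℝ) ≤ 42 / ε ∧
      (A.space : ℝ) ≤ C * (k / ε ^ 2) * Real.log (2 * n * m / ε) ^ 3 ∧
      ∀ L : Fin m → List (Fin n),
        1 - 1 / ((n : ℝ) * m) ^ c ≤ ((A.run (setStream L)).toOuterMeasure
          {I | I.card ≤ k ∧
            (1 - 1 / Real.exp 1 - ε) * (optCoverage L k : ℝ) ≤ (coverage L I : ℝ)}).toReal := by
  set κ : ℝ := 800 * (c + 12) + 2 with hκ
  refine ⟨2 * (4 * (c + 11) + 16 * κ + 200) + 8, ?_⟩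
  intro n m k ε hn hm hk hε hε1
  have hn1 : (1 : ℝ) ≤ n := by exact_mod_cast hn
  have hm1 : (1 : ℝ) ≤ m := by exact_mod_cast hm
  have hk1 : (1 : ℝ) ≤ k := by exact_mod_cast hk
  have hnm : (1 : ℝ) ≤ n * m := by nlinarith
  set Λ : ℝ := Real.log (2 * n * m / ε) with hΛ
  -- All relevant logarithms are bounded by multiples of `Λ ≥ log 2`.
  have hbig : 2 * (n * m : ℝ) ≤ 2 * n * m / ε := by
    rw [le_div_iff₀ hε]; nlinarith
  have hΛ2 : Real.log 2 ≤ Λ := Real.log_le_log (by norm_num) (by linarith)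
  have hΛh : 1 / 2 ≤ Λ := by linarith [Real.log_two_gt_d9]
  have hlogn : Real.log (n + 1) ≤ Λ := log_add_one_le_log hn1 (by nlinarith)
  have hlogm : Real.log (m + 1) ≤ Λ := log_add_one_le_log hm1 (by nlinarith)
  have hlognm : Real.log (n * m) ≤ Λ := Real.log_le_log (by linarith) (by linarith)
  have hlogε : Real.log (1 / ε) ≤ Λ := by
    refine Real.log_le_log (by positivity) ?_
    gcongr
    nlinarith
  set J : ℕ := Nat.log 2 n + 2 with hJ
  have hJΛ : ((J : ℝ) + 1) ≤ 8 * Λ := by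
    have h1 : (Nat.log 2 n : ℝ) * Real.log 2 ≤ Real.log (n + 1) := by
      rw [← Real.log_pow]
      refine Real.log_le_log (by positivity) ?_
      have h2 : ((2 ^ Nat.log 2 n : ℕ) : ℝ) ≤ n := Nat.cast_le.2 (Nat.pow_log_le_self 2 hn.ne')
      push_cast at h2
      linarith
    have h3 : (0 : ℝ) ≤ Nat.log 2 n := by positivity
    rw [hJ]
    push_cast
    nlinarith [Real.log_two_gt_d9]
  set M : ℝ := (n * m) ^ c * (J + 1) with hM
  have hM0 : 0 < M := by positivity
  have hlogM : Real.log M ≤ (c + 8) * Λ := by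
    rw [hM, Real.log_mul (by positivity) (by positivity), Real.log_pow]
    have h1 : Real.log ((J : ℝ) + 1) ≤ 8 * Λ :=
      (Real.log_le_sub_one_of_pos (by positivity)).trans (by linarith)
    have h2 := mul_le_mul_of_nonneg_left hlognm (Nat.cast_nonneg (α := ℝ) c)
    linarith
  set η : ℝ := ε / 10 with hη
  have hη0 : 0 < η := by positivity
  set X : ℝ := 8 * (m + 1) ^ k * M with hX
  have hlogX : Real.log X ≤ k * (c + 12) * Λ := by
    have h8 : Real.log 8 = 3 * Real.log 2 := by
      rw [show (8 : ℝ) = 2 ^ 3 by norm_num, Real.log_pow]; norm_num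
    rw [hX, Real.log_mul (by positivity) (by positivity),
      Real.log_mul (by norm_num) (by positivity), Real.log_pow, h8]
    have h1 := mul_le_mul_of_nonneg_left hlogm (Nat.cast_nonneg (α := ℝ) k)
    have h2 : ((c : ℝ) + 11) * Λ ≤ k * ((c + 11) * Λ) :=
      le_mul_of_one_le_left (by positivity) hk1
    linarith
  have hX1 : 0 < Real.log X := by
    refine Real.log_pos ?_
    have h1 : (1 : ℝ) ≤ (m + 1) ^ k := one_le_pow₀ (by linarith)
    have h2 : (1 : ℝ) ≤ (n * m) ^ c := one_le_pow₀ hnm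
    have h3 : (1 : ℝ) ≤ M := one_le_mul_of_one_le_of_one_le h2
      (by linarith [Nat.cast_nonneg (α := ℝ) J])
    nlinarith [one_le_mul_of_one_le_of_one_le h1 h3]
  set K : ℕ := ⌈8 / η ^ 2 * Real.log X⌉₊ with hKdef
  have hK0 : 0 < K := Nat.ceil_pos.2 (by positivity)
  set a : ℝ := k / ε ^ 2 with ha
  have hka : (k : ℝ) ≤ a := by
    rw [ha, le_div_iff₀ (by positivity)]
    exact mul_le_of_le_one_right (by positivity) (pow_le_one₀ hε.le hε1.le)
  have ha1 : 1 ≤ a := hk1.trans hka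
  have hKle : (K : ℝ) ≤ κ * (a * Λ) := by
    have h1 : (K : ℝ) ≤ 8 / η ^ 2 * Real.log X + 1 := (Nat.ceil_lt_add_one (by positivity)).le
    have h2 : 8 / η ^ 2 * Real.log X ≤ 8 / η ^ 2 * (k * (c + 12) * Λ) := by gcongr
    have h3 : 8 / η ^ 2 * (k * (c + 12) * Λ) = 800 * (c + 12) * (a * Λ) := by
      rw [hη, ha]; field_simp; ring
    have h4 : 1 ≤ 2 * (a * Λ) := by nlinarith
    rw [hκ]
    linarith
  set N : ℕ := ⌈4 / η⌉₊ with hN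
  have hNle : (N : ℝ) ≤ 40 / ε + 1 := by
    have h1 : (N : ℝ) ≤ 4 / η + 1 := (Nat.ceil_lt_add_one (by positivity)).le
    have h2 : 4 / η = 40 / ε := by rw [hη]; field_simp; norm_num
    linarith
  have hε' : 1 ≤ 1 / ε := by rw [le_div_iff₀ hε]; linarith
  have e40 : 40 / ε = 40 * (1 / ε) := by ring
  have hlogN : Real.log (((N + 1 : ℕ) : ℝ) + 2) ≤ 7 * Λ := by
    have h1 : ((N + 1 : ℕ) : ℝ) + 2 ≤ 2 ^ 6 * (1 / ε) := by push_cast; linarith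
    have h2 := Real.log_le_log (by positivity) h1
    rw [Real.log_mul (by norm_num) (by positivity), Real.log_pow] at h2
    push_cast at h2 ⊢
    linarith
  set T : ℕ := ⌈2 * (n * m) * M⌉₊ with hT
  have hlogT : Real.log ((T : ℝ) + 1) ≤ (c + 11) * Λ := by
    have h1 : (T : ℝ) ≤ 2 * (n * m) * M + 1 := (Nat.ceil_lt_add_one (by positivity)).le
    have h3 : (1 : ℝ) ≤ M := one_le_mul_of_one_le_of_one_le (one_le_pow₀ hnm)
      (by linarith [Nat.cast_nonneg (α := ℝ) J])
    have h4 : (1 : ℝ) ≤ n * m * M := one_le_mul_of_one_le_of_one_le hnm h3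
    have h5 : (T : ℝ) + 1 ≤ 2 ^ 2 * (n * m * M) := by linarith
    have h6 := Real.log_le_log (by positivity) h5
    rw [Real.log_mul (by norm_num) (by positivity), Real.log_mul (by positivity) (by positivity),
      Real.log_pow] at h6
    push_cast at h6
    linarith
  obtain ⟨ω, hω⟩ := exists_sampling_tables (k := k) (K := K) (J := J) (T := T) (η := η) (M := M)
    hn hm hη0 (by linarith) hM0 (Nat.le_ceil _) (Nat.le_ceil _)
  refine ⟨coverAlg K k (N + 1) J T η ω, ?_, ?_, fun L => ?_⟩
  · change ((N + 1 : ℕ) : ℝ) ≤ 42 / ε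
    have e42 : 42 / ε = 42 * (1 / ε) := by ring
    push_cast
    linarith
  · refine space_coverAlg_le.trans ?_
    exact space_bound_le (c := c) (κ := κ) (by positivity) ha1 hΛh hlogT hJΛ hKle
      (by positivity) hka (by positivity) (Real.log_nonneg (by linarith)) hlogn
      (Real.log_nonneg (by linarith)) hlogm
      (Real.log_nonneg (by linarith [Nat.cast_nonneg (α := ℝ) (N + 1)])) hlogN
  · have h := le_run_coverAlg (n := n) (m := m) (L := L) (δ := 1 / M) (ω := ω) hk hK0 hη0
      (by linarith) (Nat.le_ceil _) le_rfl fun j => hω j _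
    have e1 : ((J : ℝ) + 1) * (1 / M) = 1 / ((n : ℝ) * m) ^ c := by
      rw [hM]; field_simp
    have e2 : 10 * η = ε := by rw [hη]; ring
    rw [e1, e2] at h
    exact h

theorem mainTheorem1 :
    ∃ (P : ℝ) (d : ℕ), ∀ c : ℕ, ∃ C : ℝ,
      ∃ A : (n m k : ℕ) → (ε : ℝ) → StreamAlg (SetToken n m) (Finset (Fin m)),
        ∀ (n m k : ℕ) (ε : ℝ), 0 < n → 0 < m → 0 < k → 0 < ε → ε < 1 →
          ((A n m k ε).passes : ℝ) ≤ P / ε ∧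
          ((A n m k ε).space : ℝ) ≤
            C * (k / ε ^ 2) * Real.log (2 * n * m / ε) ^ d ∧
          ∀ L : Fin m → List (Fin n), (∀ i, (L i).Nodup) →
            1 - 1 / ((n : ℝ) * m) ^ c ≤
              (((A n m k ε).run (setStream L)).toOuterMeasure
                {I | I.card ≤ k ∧
                  (1 - 1 / Real.exp 1 - ε) * (optCoverage L k : ℝ) ≤ (coverage L I : ℝ)}).toReal := by
  classical
  refine ⟨42, 3, fun c => ?_⟩
  obtain ⟨C, hC⟩ := exists_coverAlg c
  have hA : ∀ (n m k : ℕ) (ε : ℝ), ∃ A : StreamAlg (SetToken n m) (Finset (Fin m)),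
      0 < n → 0 < m → 0 < k → 0 < ε → ε < 1 → _ := fun n m k ε => by
    by_cases h : 0 < n ∧ 0 < m ∧ 0 < k ∧ 0 < ε ∧ ε < 1
    · obtain ⟨A, hA⟩ := hC n m k ε h.1 h.2.1 h.2.2.1 h.2.2.2.1 h.2.2.2.2
      exact ⟨A, fun _ _ _ _ _ => hA⟩
    -- The parameters outside the theorem's range need some algorithm, no matter which.
    · exact ⟨coverAlg 0 0 0 0 0 0 fun _ _ _ => 0, fun h1 h2 h3 h4 h5 =>
        absurd ⟨h1, h2, h3, h4, h5⟩ h⟩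
  choose A hA using hA
  refine ⟨C, A, fun n m k ε h1 h2 h3 h4 h5 => ?_⟩
  obtain ⟨p, s, r⟩ := hA n m k ε h1 h2 h3 h4 h5
  exact ⟨p, s, fun L _ => r L⟩
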